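/- Let $A$ be an $N\times N$ matrix with nonnegative real entries (the weighted, possibly directed, adjacency matrix of a network), let $0<\alpha<1$, $\beta>0$ and $w_0\in[0,1]^N$. Write $D_t^\alpha u(t)=\int_0^t \frac{(t-\tau)^{-\alpha}}{\Gamma(1-\alpha)}\,u'(\tau)\,d\tau$ for the Caputo derivative of a locally absolutely continuous $u:[0,\infty)\to\mathbb R$. Apply entrywise $g(x)=-\log(1-x)\in[0,\infty]$ (with $g(1)=\infty$), $f(y)=1-e^{-y}=g^{-1}(y)$ (with $f(\infty)=1$) and $b(x)=x+(1-x)\log(1-x)$ (with $b(1)=1$). In all equations below, an extended-real coordinate that is infinite at time $0$ stays equal to $\infty$, every other coordinate is finite for all $t\ge 0$ and satisfies its equation for all $t>0$, and $0\cdot\infty=0$. Let $w:[0,\infty)\to[0,1]^N$ be a solution of the fractional logistic (SI) waste-congestion model $$D_t^\alpha\bigl(-\log(\mathbf 1-w)\bigr)(t)=\beta^\alpha A\,w(t),\qquad w(0)=w_0 .$$ Put $\hat A=A\,\mathrm{diag}(\mathbf 1-w_0)$ and consider the linearized (Lee–Tenneti–Eun) system $$D_t^\alpha\hat y(t)=\beta^\alpha\hat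 A\,\hat y(t)+\beta^\alpha A\,b(w_0),\qquad \hat y(0)=g(w_0).$$ 1. This system has exactly one solution $\hat y$ on $[0,\infty)$, and it is given by the convergent series $$\hat y(t)=E_{\alpha,1}\bigl((\beta t)^\alpha\hat A\bigr)g(w_0)+\sum_{n=0}^\infty\frac{(\beta t)^{\alpha(n+1)}\hat A^nA\,b(w_0)}{\Gamma(\alpha(n+1)+1)},\qquad E_{\alpha,1}(M)=\sum_{k=0}^\infty\frac{M^k}{\Gamma(\alpha k+1)} .$$ 2. With $\hat w=f(\hat y)=\mathbf 1-e^{-\hat y}$, one has $w_i(t)\le\hat w_i(t)$ for every $i$ and every $t\ge 0$. 3. $\|\hat w(t)-w(t)\|\to 0$ as $t\to\infty$. 4. Let $\tilde w$ be the solution of the linearization of the model at zero, $D_t^\alpha\tilde w(t)=\beta^\alpha A\,\tilde w(t)$, $\tilde w(0)=w_0$. If $Aw_0\neq 0$, then $\|\tilde w(t)-w(t)\|\to\infty$ as $t\to\infty$. -/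

import Mathlib

open scoped Matrix Topology
open Filter

noncomputable section

namespace WasteCongestion

/-- The kernel `g_a(t) = t^(a-1) / Γ(a)` of fractional integration of order `a > 0`. -/
def fracKernel (a t : ℝ) : ℝ := t ^ (a - 1) / Real.Gamma a

/-- `u` has on `[0, ∞)` the Caputo derivative `h` of order `α`, `0 < α < 1`: `u` is locally
absolutely continuous on `[0, ∞)` and, for every `t > 0`, the integral
`∫_0^t g_{1-α}(t-τ) u'(τ) dτ` converges absolutely and equals `h t`. -/
structure HasCaputoDeriv (α : ℝ) (u h : ℝ → ℝ) : Prop where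
  absCont : ∀ T : ℝ, 0 < T → AbsolutelyContinuousOnInterval u 0 T
  integrable : ∀ t : ℝ, 0 < t → IntervalIntegrable
    (fun τ => fracKernel (1 - α) (t - τ) * deriv u τ) MeasureTheory.volume 0 t
  integral_eq : ∀ t : ℝ, 0 < t →
    ∫ τ in (0 : ℝ)..t, fracKernel (1 - α) (t - τ) * deriv u τ = h t

/-- The equation `D_t^α y = h` for an extended-real-valued `y`: either `y` is finite on `[0, ∞)`
and the equation holds in the usual sense, or `y` is identically `+∞` on `[0, ∞)`
(a coordinate that starts at `+∞` stays there). -/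
def HasCaputoDerivExt (α : ℝ) (y : ℝ → EReal) (h : ℝ → ℝ) : Prop :=
  (∀ t : ℝ, 0 ≤ t → y t = ⊤) ∨
    ((∀ t : ℝ, 0 ≤ t → y t ≠ ⊤ ∧ y t ≠ ⊥) ∧ HasCaputoDeriv α (fun t => (y t).toReal) h)

/-- `g(w) = -log(1 - w)` as a map `[0, 1] → [0, ∞]`, with `g(1) = +∞`. -/
def gFun (w : ℝ) : EReal := if w < 1 then ((-Real.log (1 - w) : ℝ) : EReal) else ⊤

/-- `f(y) = 1 - e^(-y)` as a map `[0, ∞] → [0, 1]`, with `f(+∞) = 1`. -/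
def fFun (y : EReal) : ℝ := 1 - (EReal.exp (-y)).toReal

/-- `b(w) = w + (1 - w) log(1 - w)`, with `b(1) = 1` (here `0 * log 0 = 0`). -/
def bFun (w : ℝ) : ℝ := w + (1 - w) * Real.log (1 - w)

variable {ι : Type*} [Fintype ι] [DecidableEq ι]

/-- `Â = A · diag(1 - w₀)`. -/
def hatMatrix (A : Matrix ι ι ℝ) (w₀ : ι → ℝ) : Matrix ι ι ℝ :=
  A * Matrix.diagonal (fun i => 1 - w₀ i)

/-- The terms of the power series of the Mittag-Leffler function `E_{α,1}(M)`. -/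
def mittagLefflerTerm (α : ℝ) (M : Matrix ι ι ℝ) (k : ℕ) : Matrix ι ι ℝ :=
  (Real.Gamma (α * k + 1))⁻¹ • M ^ k

/-- The Mittag-Leffler function `E_{α,1}(M) = ∑_k M^k / Γ(α k + 1)`. -/
def mittagLeffler (α : ℝ) (M : Matrix ι ι ℝ) : Matrix ι ι ℝ :=
  ∑' k : ℕ, mittagLefflerTerm α M k

/-- `w : [0, ∞) → [0, 1]^ι` solves `D_t^α (-log(1 - w)) = β^α A w` with `w(0) = w₀`. -/
structure IsExactSolution (α β : ℝ) (A : Matrix ι ι ℝ) (w₀ : ι → ℝ) (w : ℝ → ι → ℝ) :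
    Prop where
  initial : w 0 = w₀
  mem_Icc : ∀ t : ℝ, 0 ≤ t → ∀ i, w t i ∈ Set.Icc (0 : ℝ) 1
  equation : ∀ i, HasCaputoDerivExt α (fun t => gFun (w t i))
    (fun t => β ^ α * (A *ᵥ w t) i)

/-- `y` solves `D_t^α y = β^α A diag(1 - w₀) y + β^α A b(w₀)` with `y(0) = g(w₀)`.
A coordinate `y_j = +∞` enters the right-hand side only with coefficient `0`, since then
`w₀_j = 1`, and `0 · ∞ = 0`; this is what `EReal.toReal` gives. -/
structure IsLTESolution (α β : ℝ) (A : Matrix ι ι ℝ) (w₀ : ι → ℝ) (y : ℝ → ι → EReal) :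
    Prop where
  initial : y 0 = fun i => gFun (w₀ i)
  equation : ∀ i, HasCaputoDerivExt α (fun t => y t i)
    (fun t => β ^ α * (hatMatrix A w₀ *ᵥ fun j => (y t j).toReal) i
      + β ^ α * (A *ᵥ fun j => bFun (w₀ j)) i)

/-- `w` solves the linearization at zero of the model, `D_t^α w = β^α A w`, with `w(0) = w₀`. -/
structure IsLinearSolution (α β : ℝ) (A : Matrix ι ι ℝ) (w₀ : ι → ℝ) (w : ℝ → ι → ℝ) :
    Prop where
  initial : w 0 = w₀
  equation : ∀ i, HasCaputoDeriv α (fun t => w t i) (fun t => β ^ α * (A *ᵥ w t) i)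

/-- The terms `(βt)^(α(n+1)) Â^n A b(w₀) / Γ(α(n+1)+1)` of the inhomogeneous part. -/
def forcingTerm (α β : ℝ) (A : Matrix ι ι ℝ) (w₀ : ι → ℝ) (t : ℝ) (n : ℕ) : ι → ℝ :=
  ((β * t) ^ (α * (n + 1)) / Real.Gamma (α * (n + 1) + 1)) •
    ((hatMatrix A w₀ ^ n * A) *ᵥ fun j => bFun (w₀ j))

/-- `E_{α,1}((βt)^α Â) g(w₀) + ∑_n (βt)^(α(n+1)) Â^n A b(w₀) / Γ(α(n+1)+1)`, computed
in the extended reals (where `0 * ⊤ = 0`). -/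
def lteSeries (α β : ℝ) (A : Matrix ι ι ℝ) (w₀ : ι → ℝ) (t : ℝ) (i : ι) : EReal :=
  (∑ j, ((mittagLeffler α ((β * t) ^ α • hatMatrix A w₀) i j : ℝ) : EReal) * gFun (w₀ j))
    + (((∑' n : ℕ, forcingTerm α β A w₀ t n) i : ℝ) : EReal)

end WasteCongestion

end

open WasteCongestion

/-! Fractional integration inverts the Caputo derivative: `HasCaputoDeriv.eq_add_integral` turns
every equation into a Volterra equation with nonnegative kernel. Iterating a Volterra inequality
with a nonnegative matrix multiplies a constant bound by `K^n t^(αn) / Γ(αn+1)`, which tends to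
zero. This fractional Gronwall inequality, `nonpos_of_le_integral`, is the comparison tool behind
uniqueness, the upper bound and the sign arguments.

Existence: Caputo differentiation sends `t^(αk) / Γ(αk+1)` to the term with index `k - 1`, so a
series solves the linearized system once its coefficients satisfy the recursion `lteCoeff_succ`.

Upper bound: in the variable `u = -log(1 - w)` the model has right side `A f(u)` with `f` concave.
The linearized system replaces `f` by its tangent at `g(w₀)`, which lies above `f`, and Gronwall
gives `u ≤ ŷ`.

Asymptotics: call a node live if its `w` is eventually bounded below by a positive constant. If a
live node feeds `i` and `w₀ i < 1`, the derivative of `u_i` is eventually bounded below, so `u_i`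
grows at least like `t^α`; then `w_i → 1`, and `ŵ_i`, lying between `w_i` and `1`, follows. Nodes
that are not live start at zero and have no live in-neighbour, so `w` and `ŷ` vanish on them. A node
without live in-neighbours therefore has both derivatives zero and keeps its common initial value.
In the linearization at zero, a coordinate with `(A w₀)_i > 0` grows at least like `t^α`, whereas
`w` stays in `[0, 1]`. -/

noncomputable section

namespace WasteCongestion

open MeasureTheory

/-! ### Fractional integrals: semigroup law and inversion of the Caputo derivative -/

section

/-- The fractional kernel extended by zero to the whole line. -/
def posKernel (a : ℝ) : ℝ → ℝ := (Set.Ioi 0).indicator (fracKernel a)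

lemma posKernel_of_pos {a x : ℝ} (hx : 0 < x) : posKernel a x = fracKernel a x :=
  Set.indicator_of_mem (Set.mem_Ioi.2 hx) _

lemma posKernel_of_nonpos {a x : ℝ} (hx : x ≤ 0) : posKernel a x = 0 :=
  Set.indicator_of_notMem (by simpa using hx) _

lemma measurable_fracKernel (a : ℝ) : Measurable (fracKernel a) := by
  unfold fracKernel; fun_prop

lemma measurable_posKernel (a : ℝ) : Measurable (posKernel a) :=
  (measurable_fracKernel a).indicator measurableSet_Ioi

lemma fracKernel_nonneg {a x : ℝ} (ha : 0 < a) (hx : 0 ≤ x) : 0 ≤ fracKernel a x :=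
  div_nonneg (Real.rpow_nonneg hx _) (Real.Gamma_pos_of_pos ha).le

lemma fracKernel_pos {a x : ℝ} (ha : 0 < a) (hx : 0 < x) : 0 < fracKernel a x :=
  div_pos (Real.rpow_pos_of_pos hx _) (Real.Gamma_pos_of_pos ha)

lemma posKernel_nonneg {a : ℝ} (ha : 0 < a) (x : ℝ) : 0 ≤ posKernel a x :=
  Set.indicator_nonneg (fun _ hx => fracKernel_nonneg ha (le_of_lt hx)) x

lemma fracKernel_one (x : ℝ) : fracKernel 1 x = 1 := by simp [fracKernel]

/-- Integrals over `[0, t]` against a function supported on the positive half-line. -/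
lemma integral_posKernel_mul_indicator {a t : ℝ} (ht : 0 ≤ t) (h : ℝ → ℝ) :
    ∫ s, posKernel a (t - s) * (Set.Ioi 0).indicator h s
      = ∫ s in (0 : ℝ)..t, fracKernel a (t - s) * h s := by
  have : (fun s => posKernel a (t - s) * (Set.Ioi 0).indicator h s)
      = (Set.Ioo 0 t).indicator (fun s => fracKernel a (t - s) * h s) := by
    ext s
    by_cases h1 : 0 < s <;> by_cases h2 : s < t <;>
      simp [posKernel, h1, h2, Set.indicator]
  rw [this, integral_indicator measurableSet_Ioo, intervalIntegral.integral_of_le ht,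
    integral_Ioc_eq_integral_Ioo]

lemma integrable_posKernel_mul_indicator_iff {a t : ℝ} (ht : 0 ≤ t) (h : ℝ → ℝ) :
    Integrable (fun s => posKernel a (t - s) * (Set.Ioi 0).indicator h s)
      ↔ IntervalIntegrable (fun s => fracKernel a (t - s) * h s) volume 0 t := by
  have : (fun s => posKernel a (t - s) * (Set.Ioi 0).indicator h s)
      = (Set.Ioo 0 t).indicator (fun s => fracKernel a (t - s) * h s) := by
    ext s
    by_cases h1 : 0 < s <;> by_cases h2 : s < t <;>
      simp [posKernel, h1, h2, Set.indicator]
  rw [this, integrable_indicator_iff measurableSet_Ioo, intervalIntegrable_iff_integrableOn_Ioo_of_le ht]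

/-- Euler's beta integral: `g_a ∗ g_b = g_{a+b}` on `[0, t]`. -/
lemma integral_fracKernel_mul {a b t : ℝ} (ha : 0 < a) (hb : 0 < b) (ht : 0 < t) :
    ∫ s in (0 : ℝ)..t, fracKernel a (t - s) * fracKernel b s = fracKernel (a + b) t := by
  have key : ∫ s in (0 : ℝ)..t, s ^ (b - 1) * (t - s) ^ (a - 1)
      = t ^ (b + a - 1) * (Real.Gamma b * Real.Gamma a / Real.Gamma (b + a)) := by
    have h1 := Complex.betaIntegral_scaled (b : ℂ) (a : ℂ) ht
    have h2 := Complex.Gamma_mul_Gamma_eq_betaIntegral (s := (b : ℂ)) (t := (a : ℂ))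
      (by simpa using hb) (by simpa using ha)
    have h3 : Complex.betaIntegral b a
        = ((Real.Gamma b * Real.Gamma a / Real.Gamma (b + a) : ℝ) : ℂ) := by
      have h4 : (Real.Gamma (b + a) : ℂ) ≠ 0 := by
        exact_mod_cast (Real.Gamma_pos_of_pos (by positivity)).ne'
      rw [← Complex.ofReal_add, Complex.Gamma_ofReal, Complex.Gamma_ofReal,
        Complex.Gamma_ofReal] at h2
      push_cast
      rw [eq_div_iff h4, h2, mul_comm]
    have h5 : ∫ x in (0 : ℝ)..t, (x : ℂ) ^ ((b : ℂ) - 1) * ((t : ℂ) - x) ^ ((a : ℂ) - 1)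
        = ∫ x in (0 : ℝ)..t, ((x ^ (b - 1) * (t - x) ^ (a - 1) : ℝ) : ℂ) := by
      refine intervalIntegral.integral_congr fun x hx => ?_
      rw [Set.uIcc_of_le ht.le] at hx
      have e1 := Complex.ofReal_cpow hx.1 (b - 1)
      have e2 := Complex.ofReal_cpow (sub_nonneg.2 hx.2) (a - 1)
      push_cast at e1 e2 ⊢
      rw [e1, e2]
    rw [h5, intervalIntegral.integral_ofReal, h3] at h1
    have e3 := Complex.ofReal_cpow ht.le (b + a - 1)
    push_cast at e3
    rw [← e3] at h1
    exact_mod_cast h1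
  have e : ∀ s, fracKernel a (t - s) * fracKernel b s
      = (Real.Gamma a * Real.Gamma b)⁻¹ * (s ^ (b - 1) * (t - s) ^ (a - 1)) := by
    intro s; simp only [fracKernel]; field_simp
  simp_rw [e]
  rw [intervalIntegral.integral_const_mul, key, fracKernel, add_comm b a]
  have := (Real.Gamma_pos_of_pos ha).ne'
  have := (Real.Gamma_pos_of_pos hb).ne'
  field_simp

lemma integral_posKernel_mul_posKernel {a b : ℝ} (ha : 0 < a) (hb : 0 < b) (t τ : ℝ) :
    ∫ s, posKernel a (t - s) * posKernel b (s - τ) = posKernel (a + b) (t - τ) := by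
  have h := integral_sub_right_eq_self
    (fun s => posKernel a (t - τ - s) * posKernel b s) τ (μ := volume)
  simp only [sub_sub_sub_cancel_right] at h
  rw [h]
  rcases le_or_gt (t - τ) 0 with h0 | h0
  · rw [posKernel_of_nonpos h0]
    refine integral_eq_zero_of_ae (Eventually.of_forall fun s => ?_)
    rcases le_or_gt s 0 with hs | hs
    · simp [posKernel_of_nonpos hs]
    · simp [posKernel_of_nonpos (a := a) (x := t - τ - s) (by linarith)]
  · rw [posKernel_of_pos h0, ← integral_fracKernel_mul ha hb h0]
    exact integral_posKernel_mul_indicator h0.le _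

lemma integrable_posKernel_mul_posKernel {a b : ℝ} (ha : 0 < a) (hb : 0 < b) (t τ : ℝ) :
    Integrable (fun s => posKernel a (t - s) * posKernel b (s - τ)) := by
  rcases le_or_gt (t - τ) 0 with h0 | h0
  · refine (integrable_zero ℝ ℝ volume).congr (Eventually.of_forall fun s => ?_)
    rcases le_or_gt s τ with hs | hs
    · simp [posKernel_of_nonpos (a := b) (x := s - τ) (by linarith)]
    · simp [posKernel_of_nonpos (a := a) (x := t - s) (by linarith)]
  -- A non-integrable function has integral zero by convention, so the nonzero value forces
  -- integrability.
  · refine .of_integral_ne_zero ?_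
    rw [integral_posKernel_mul_posKernel ha hb, posKernel_of_pos h0]
    exact (fracKernel_pos (by positivity) h0).ne'

lemma intervalIntegrable_fracKernel_mul {a b t : ℝ} (ha : 0 < a) (hb : 0 < b) (ht : 0 ≤ t) :
    IntervalIntegrable (fun s => fracKernel a (t - s) * fracKernel b s) volume 0 t := by
  rw [← integrable_posKernel_mul_indicator_iff ht]
  simpa only [sub_zero] using! integrable_posKernel_mul_posKernel ha hb t 0

/-- Associativity of convolution with the fractional kernels. -/
lemma integral_posKernel_assoc {a b t : ℝ} (ha : 0 < a) (hb : 0 < b) {v : ℝ → ℝ}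
    (hv : Measurable v) (hint : Integrable (fun τ => posKernel (a + b) (t - τ) * v τ)) :
    ∫ s, posKernel a (t - s) * ∫ τ, posKernel b (s - τ) * v τ
      = ∫ τ, posKernel (a + b) (t - τ) * v τ := by
  have hm : Measurable (fun p : ℝ × ℝ =>
      posKernel a (t - p.1) * (posKernel b (p.1 - p.2) * v p.2)) :=
    ((measurable_posKernel a).comp (by fun_prop)).mul
      (((measurable_posKernel b).comp (by fun_prop)).mul (hv.comp measurable_snd))
  -- Tonelli: integrating the absolute value over `s` first leaves `posKernel (a + b) (t - τ) * |v
  -- τ|`, which is integrable by `hint`.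
  have hI : Integrable (fun p : ℝ × ℝ =>
      posKernel a (t - p.1) * (posKernel b (p.1 - p.2) * v p.2)) (volume.prod volume) := by
    rw [integrable_prod_iff' hm.aestronglyMeasurable]
    refine ⟨Eventually.of_forall fun τ => ?_, ?_⟩
    · simpa only [mul_assoc] using (integrable_posKernel_mul_posKernel ha hb t τ).mul_const (v τ)
    · refine hint.norm.congr (Eventually.of_forall fun τ => ?_)
      have : ∀ s, ‖posKernel a (t - s) * (posKernel b (s - τ) * v τ)‖
          = posKernel a (t - s) * posKernel b (s - τ) * ‖v τ‖ := fun s => by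
        rw [norm_mul, norm_mul, Real.norm_of_nonneg (posKernel_nonneg ha _),
          Real.norm_of_nonneg (posKernel_nonneg hb _), mul_assoc]
      simp only [this]
      rw [integral_mul_const, integral_posKernel_mul_posKernel ha hb, norm_mul,
        Real.norm_of_nonneg (posKernel_nonneg (by positivity) _)]
  calc ∫ s, posKernel a (t - s) * ∫ τ, posKernel b (s - τ) * v τ
      = ∫ s, ∫ τ, posKernel a (t - s) * (posKernel b (s - τ) * v τ) := by
        simp only [integral_const_mul]
    _ = ∫ τ, ∫ s, posKernel a (t - s) * (posKernel b (s - τ) * v τ) := integral_integral_swap hI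
    _ = _ := by
        simp only [← mul_assoc, integral_mul_const, integral_posKernel_mul_posKernel ha hb]

/-- A function with Caputo derivative `h` is the fractional integral of `h`. -/
theorem HasCaputoDeriv.eq_add_integral {α : ℝ} (hα₀ : 0 < α) (hα₁ : α < 1) {u h : ℝ → ℝ}
    (hu : HasCaputoDeriv α u h) {t : ℝ} (ht : 0 ≤ t) :
    u t = u 0 + ∫ s in (0 : ℝ)..t, fracKernel α (t - s) * h s := by
  rcases ht.eq_or_lt with rfl | ht
  · simp
  set v : ℝ → ℝ := (Set.Ioi 0).indicator ((Set.Ioo 0 t).indicator (deriv u)) with hvdef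
  have hv : Measurable v :=
    ((measurable_deriv u).indicator measurableSet_Ioo).indicator measurableSet_Ioi
  have hac := hu.absCont t ht
  have hd := hac.intervalIntegrable_deriv
  -- At order `1` the kernel is the constant `1`, so the composed fractional integral is `∫_0^t u'`,
  -- which absolute continuity identifies as `u t - u 0`.
  have hsum : α + (1 - α) = 1 := by ring
  have hone : (fun τ => posKernel (α + (1 - α)) (t - τ) * v τ)
      = (Set.Ioo 0 t).indicator (deriv u) := by
    ext τ
    rw [hsum]
    by_cases h1 : 0 < τ <;> by_cases h2 : τ < t <;>
      simp [hvdef, posKernel, h1, h2, Set.indicator, fracKernel_one]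
  have hint : Integrable (fun τ => posKernel (α + (1 - α)) (t - τ) * v τ) := by
    rw [hone, integrable_indicator_iff measurableSet_Ioo]
    exact (intervalIntegrable_iff_integrableOn_Ioo_of_le ht.le).1 hd
  have key := integral_posKernel_assoc hα₀ (sub_pos.2 hα₁) hv hint
  rw [hone, integral_indicator measurableSet_Ioo, ← integral_Ioc_eq_integral_Ioo,
    ← intervalIntegral.integral_of_le ht.le, hac.integral_deriv_eq_sub] at key
  have hin : ∀ s, posKernel α (t - s) * ∫ τ, posKernel (1 - α) (s - τ) * v τ
      = posKernel α (t - s) * (Set.Ioi 0).indicator h s := by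
    intro s
    rcases le_or_gt s 0 with hs | hs
    · have : ∀ τ, posKernel (1 - α) (s - τ) * v τ = 0 := fun τ => by
        rcases le_or_gt τ 0 with h1 | h1
        · simp [hvdef, h1]
        · simp [posKernel_of_nonpos (a := 1 - α) (x := s - τ) (by linarith)]
      simp [this, hs]
    rcases lt_or_ge s t with hst | hst
    · rw [integral_posKernel_mul_indicator hs.le, Set.indicator_of_mem (Set.mem_Ioi.2 hs),
        ← hu.integral_eq s hs]
      congr 1
      rw [intervalIntegral.integral_of_le hs.le, intervalIntegral.integral_of_le hs.le]
      refine setIntegral_congr_fun measurableSet_Ioc fun τ hτ => ?_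
      simp [Set.indicator, hτ.1, hτ.2.trans_lt hst]
    · simp [posKernel_of_nonpos (a := α) (x := t - s) (by linarith)]
  simp only [hin] at key
  rw [integral_posKernel_mul_indicator ht.le] at key
  linarith

end

/-! ### Mittag-Leffler type series and their Caputo derivatives -/

section

/-- Cut the Gamma integral down to `(R, ∞)`, where `x^s ≥ R^s`. This crude bound does the work of
Stirling's formula in the convergence proofs. -/
lemma rpow_mul_exp_neg_le_Gamma {R s : ℝ} (hR : 0 ≤ R) (hs : 0 ≤ s) :
    R ^ s * Real.exp (-R) ≤ Real.Gamma (s + 1) := by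
  rw [Real.Gamma_eq_integral (by positivity), ← integral_exp_neg_Ioi R, ← integral_const_mul]
  have hI := Real.GammaIntegral_convergent (s := s + 1) (by positivity)
  have hsub : Set.Ioi R ⊆ Set.Ioi 0 := Set.Ioi_subset_Ioi hR
  refine (setIntegral_mono_on ((integrableOn_exp_neg_Ioi R).const_mul _) (hI.mono_set hsub)
    measurableSet_Ioi fun x hx => ?_).trans
    (setIntegral_mono_set hI ?_ hsub.eventuallyLE)
  · rw [add_sub_cancel_right, mul_comm]
    exact mul_le_mul_of_nonneg_left (Real.rpow_le_rpow hR (le_of_lt hx) hs) (Real.exp_pos _).le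
  · filter_upwards [ae_restrict_mem measurableSet_Ioi] with x hx
    exact mul_nonneg (Real.exp_pos _).le (Real.rpow_nonneg (le_of_lt hx) _)

/-- The Mittag-Leffler power series has infinite radius of convergence. -/
lemma summable_pow_div_Gamma {α : ℝ} (hα : 0 < α) {x : ℝ} (hx : 0 ≤ x) :
    Summable fun k : ℕ => x ^ k / Real.Gamma (α * k + 1) := by
  -- Chosen so that `R^(αk) = (2x)^k`; the Gamma bound then dominates the series by `e^R 2^(-k)`.
  set R : ℝ := (2 * x) ^ α⁻¹ with hR
  have hR0 : 0 ≤ R := by positivity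
  have hRα : R ^ α = 2 * x := Real.rpow_inv_rpow (by positivity) hα.ne'
  refine Summable.of_nonneg_of_le (fun k => ?_) (fun k => ?_)
    ((summable_geometric_of_lt_one (r := (1 / 2 : ℝ)) (by norm_num) (by norm_num)).mul_left
      (Real.exp R))
  · exact div_nonneg (pow_nonneg hx _) (Real.Gamma_pos_of_pos (by positivity)).le
  · rw [div_le_iff₀ (Real.Gamma_pos_of_pos (by positivity))]
    have h1 := rpow_mul_exp_neg_le_Gamma hR0 (s := α * k) (by positivity)
    rw [Real.rpow_mul hR0, hRα, Real.rpow_natCast] at h1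
    calc x ^ k = Real.exp R * (1 / 2) ^ k * ((2 * x) ^ k * Real.exp (-R)) := by
          rw [Real.exp_neg, mul_pow, one_div, inv_pow]; field_simp
      _ ≤ _ := by gcongr

lemma integrable_tsum_of_summable_integral_norm {X : Type*} [MeasurableSpace X] {μ : Measure X}
    {F : ℕ → X → ℝ} (hF : ∀ i, Integrable (F i) μ) (hs : Summable fun i => ∫ a, ‖F i a‖ ∂μ) :
    Integrable (fun a => ∑' i, F i a) μ := by
  refine ⟨(AEMeasurable.tsum fun i => (hF i).aemeasurable).aestronglyMeasurable, ?_⟩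
  calc ∫⁻ a, ‖∑' i, F i a‖ₑ ∂μ ≤ ∫⁻ a, ∑' i, ‖F i a‖ₑ ∂μ :=
        lintegral_mono fun a => enorm_tsum_le_tsum_enorm
    _ = ∑' i, ∫⁻ a, ‖F i a‖ₑ ∂μ := lintegral_tsum fun i => (hF i).1.enorm
    _ = ∑' i, ENNReal.ofReal (∫ a, ‖F i a‖ ∂μ) := by
        simp only [ofReal_integral_norm_eq_lintegral_enorm (hF _)]
    _ < ⊤ := hs.tsum_ofReal_lt_top

/-- Termwise fractional integration of a series of fractional kernels. -/
lemma fracKernel_mul_tsum {a t : ℝ} (ha : 0 < a) (ht : 0 < t) {b d : ℕ → ℝ} (hb : ∀ k, 0 < b k)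
    (hd : Summable fun k => |d k| * fracKernel (a + b k) t) :
    IntervalIntegrable (fun s => fracKernel a (t - s) * ∑' k, d k * fracKernel (b k) s)
        volume 0 t ∧
      ∫ s in (0 : ℝ)..t, fracKernel a (t - s) * ∑' k, d k * fracKernel (b k) s
        = ∑' k, d k * fracKernel (a + b k) t := by
  set F : ℕ → ℝ → ℝ := fun k s => d k * (fracKernel a (t - s) * fracKernel (b k) s) with hFdef
  have hF : ∀ s, fracKernel a (t - s) * ∑' k, d k * fracKernel (b k) s = ∑' k, F k s := fun s => by
    rw [← tsum_mul_left]
    exact tsum_congr fun k => by simp only [hFdef]; ring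
  have hInt : ∀ k, Integrable (F k) (volume.restrict (Set.Ioc 0 t)) := fun k =>
    ((intervalIntegrable_iff_integrableOn_Ioc_of_le ht.le).1
      (intervalIntegrable_fracKernel_mul ha (hb k) ht.le)).const_mul _
  have hval : ∀ k, ∫ s in Set.Ioc 0 t, fracKernel a (t - s) * fracKernel (b k) s
      = fracKernel (a + b k) t := fun k => by
    rw [← intervalIntegral.integral_of_le ht.le, integral_fracKernel_mul ha (hb k) ht]
  have hnorm : ∀ k, ∫ s in Set.Ioc 0 t, ‖F k s‖ = |d k| * fracKernel (a + b k) t := fun k => by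
    rw [← hval, ← integral_const_mul]
    refine setIntegral_congr_fun measurableSet_Ioc fun s hs => ?_
    simp only [hFdef, norm_mul, Real.norm_eq_abs]
    rw [abs_of_nonneg (fracKernel_nonneg ha (sub_nonneg.2 hs.2)),
      abs_of_nonneg (fracKernel_nonneg (hb k) hs.1.le)]
  have hs : Summable fun k => ∫ s in Set.Ioc 0 t, ‖F k s‖ := by simpa only [hnorm] using hd
  simp only [hF]
  refine ⟨(intervalIntegrable_iff_integrableOn_Ioc_of_le ht.le).2
    (integrable_tsum_of_summable_integral_norm hInt hs), ?_⟩
  rw [intervalIntegral.integral_of_le ht.le, ← integral_tsum_of_summable_integral_norm hInt hs]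
  exact tsum_congr fun k => by rw [integral_const_mul, hval]

lemma AbsolutelyContinuousOnInterval.of_eq_const_add {f g : ℝ → ℝ} {a b C : ℝ}
    (hf : AbsolutelyContinuousOnInterval f a b) (h : ∀ x ∈ Set.uIcc a b, g x = C + f x) :
    AbsolutelyContinuousOnInterval g a b := by
  rw [absolutelyContinuousOnInterval_iff] at hf ⊢
  intro ε hε
  obtain ⟨δ, hδ, H⟩ := hf ε hε
  refine ⟨δ, hδ, fun E hE hlt => ?_⟩
  convert H E hE hlt using 1
  refine Finset.sum_congr rfl fun i hi => ?_
  have := hE.1 i hi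
  rw [h _ this.1, h _ this.2, dist_add_left]

/-- Values at negative times can affect `deriv` on `[0, ∞)` only at the single point `0`, which the
integrals ignore. -/
lemma HasCaputoDeriv.congr {α : ℝ} {u u' h h' : ℝ → ℝ} (hu : HasCaputoDeriv α u h)
    (huu : ∀ t, 0 ≤ t → u' t = u t) (hh : ∀ t, 0 < t → h' t = h t) : HasCaputoDeriv α u' h' := by
  have hd : ∀ τ, 0 < τ → deriv u' τ = deriv u τ := fun τ hτ =>
    EventuallyEq.deriv_eq <| by
      filter_upwards [Ioi_mem_nhds hτ] with x hx using huu x (le_of_lt hx)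
  refine ⟨fun T hT => AbsolutelyContinuousOnInterval.of_eq_const_add (C := 0) (hu.absCont T hT)
    fun x hx => ?_, fun t ht => ?_, fun t ht => ?_⟩
  · rw [Set.uIcc_of_le hT.le] at hx
    rw [huu x hx.1, zero_add]
  · refine (hu.integrable t ht).congr fun τ hτ => ?_
    rw [Set.uIoc_of_le ht.le] at hτ
    simp only [hd τ hτ.1]
  · rw [hh t ht, ← hu.integral_eq t ht, intervalIntegral.integral_of_le ht.le,
      intervalIntegral.integral_of_le ht.le]
    refine setIntegral_congr_fun measurableSet_Ioc fun τ hτ => ?_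
    simp only [hd τ hτ.1]

/-- The generalized power series `∑_k c_k t^(αk) / Γ(αk+1)`. -/
def fracSeries (α : ℝ) (c : ℕ → ℝ) (t : ℝ) : ℝ := ∑' k : ℕ, c k * fracKernel (α * k + 1) t

lemma fracKernel_mul_add_one {α t : ℝ} (ht : 0 ≤ t) (k : ℕ) :
    fracKernel (α * k + 1) t = (t ^ α) ^ k / Real.Gamma (α * k + 1) := by
  rw [fracKernel, add_sub_cancel_right, Real.rpow_mul ht, Real.rpow_natCast]

lemma summable_abs_mul_fracKernel {α : ℝ} (hα : 0 < α) {c : ℕ → ℝ} {C R : ℝ} (hR : 0 ≤ R)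
    (hc : ∀ k, |c k| ≤ C * R ^ k) {t : ℝ} (ht : 0 ≤ t) :
    Summable fun k : ℕ => |c k| * fracKernel (α * k + 1) t := by
  refine Summable.of_nonneg_of_le
    (fun k => mul_nonneg (abs_nonneg _) (fracKernel_nonneg (by positivity) ht)) (fun k => ?_)
    ((summable_pow_div_Gamma hα (x := R * t ^ α) (by positivity)).mul_left C)
  calc _ ≤ C * R ^ k * fracKernel (α * k + 1) t :=
        mul_le_mul_of_nonneg_right (hc k) (fracKernel_nonneg (by positivity) ht)
    _ = _ := by rw [fracKernel_mul_add_one ht, mul_pow]; ring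

lemma summable_mul_fracKernel {α : ℝ} (hα : 0 < α) {c : ℕ → ℝ} {C R : ℝ} (hR : 0 ≤ R)
    (hc : ∀ k, |c k| ≤ C * R ^ k) {t : ℝ} (ht : 0 ≤ t) :
    Summable fun k : ℕ => c k * fracKernel (α * k + 1) t := by
  refine Summable.of_abs ((summable_abs_mul_fracKernel hα hR hc ht).congr fun k => ?_)
  rw [abs_mul, abs_of_nonneg (fracKernel_nonneg (by positivity) ht)]

lemma fracSeries_zero {α : ℝ} (hα : 0 < α) (c : ℕ → ℝ) : fracSeries α c 0 = c 0 := by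
  rw [fracSeries, tsum_eq_single 0]
  · simp [fracKernel]
  · intro k hk
    have : α ≠ 0 := hα.ne'
    rw [fracKernel_mul_add_one le_rfl, Real.zero_rpow this, zero_pow hk]
    simp

/-- Termwise Caputo differentiation of a generalized power series. -/
theorem hasCaputoDeriv_fracSeries {α : ℝ} (hα₀ : 0 < α) (hα₁ : α < 1) {c : ℕ → ℝ} {C R : ℝ}
    (hR : 0 ≤ R) (hc : ∀ k, |c k| ≤ C * R ^ k) :
    HasCaputoDeriv α (fracSeries α c) (fracSeries α fun k => c (k + 1)) := by
  -- The termwise derivative. Its kernels with `α(k+1) < 1` blow up at `0`, so it is reached by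
  -- writing the series as `c 0 + ∫ v` and using Lebesgue differentiation almost everywhere.
  set v : ℝ → ℝ := fun s => ∑' k : ℕ, c (k + 1) * fracKernel (α * (k + 1)) s with hv
  have hb : ∀ k : ℕ, 0 < α * ((k : ℝ) + 1) := fun k => by positivity
  have hc' : ∀ k, |c (k + 1)| ≤ C * R * R ^ k := fun k => (hc (k + 1)).trans_eq (by ring)
  have hA : ∀ t : ℝ, 0 < t → IntervalIntegrable v volume 0 t ∧
      fracSeries α c t = c 0 + ∫ s in (0 : ℝ)..t, v s := by
    intro t ht
    have hs : Summable fun k : ℕ => |c (k + 1)| * fracKernel (1 + α * (k + 1)) t := by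
      have := (summable_nat_add_iff 1).2 (summable_abs_mul_fracKernel hα₀ hR hc ht.le)
      refine this.congr fun k => ?_
      push_cast; rw [add_comm 1]
    obtain ⟨h1, h2⟩ := fracKernel_mul_tsum (a := 1) one_pos ht hb hs
    simp only [fracKernel_one, one_mul] at h1 h2
    refine ⟨h1, ?_⟩
    rw [h2, fracSeries, (summable_mul_fracKernel hα₀ hR hc ht.le).tsum_eq_zero_add]
    simp [fracKernel_one, add_comm (1 : ℝ)]
  have hA0 : ∀ t : ℝ, 0 ≤ t → fracSeries α c t = c 0 + ∫ s in (0 : ℝ)..t, v s := fun t ht => by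
    rcases ht.eq_or_lt with rfl | ht
    · simp [fracSeries_zero hα₀]
    · exact (hA t ht).2
  have hderiv : ∀ T : ℝ, 0 < T → ∀ᵐ x, x ∈ Set.uIoc 0 T → v x = deriv (fracSeries α c) x := by
    intro T hT
    filter_upwards [(hA T hT).1.ae_hasDerivAt_integral] with x hx hxT
    have h1 := (hx (Set.uIoc_subset_uIcc hxT) 0 Set.left_mem_uIcc).const_add (c 0)
    rw [Set.uIoc_of_le hT.le] at hxT
    refine (HasDerivAt.deriv (h1.congr_of_eventuallyEq ?_)).symm
    filter_upwards [Ioi_mem_nhds hxT.1] with y hy using hA0 y (le_of_lt hy)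
  have hB : ∀ t : ℝ, 0 < t →
      IntervalIntegrable (fun s => fracKernel (1 - α) (t - s) * v s) volume 0 t ∧
      ∫ s in (0 : ℝ)..t, fracKernel (1 - α) (t - s) * v s
        = fracSeries α (fun k => c (k + 1)) t := by
    intro t ht
    -- This identity of orders is the source of the index shift in the coefficients.
    have e : ∀ k : ℕ, 1 - α + α * (k + 1) = α * k + 1 := fun k => by ring
    have := fracKernel_mul_tsum (a := 1 - α) (sub_pos.2 hα₁) ht hb (d := fun k => c (k + 1))
      (by simpa only [e] using summable_abs_mul_fracKernel hα₀ hR hc' ht.le)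
    simp only [e] at this
    exact this
  refine ⟨fun T hT => ?_, fun t ht => ?_, fun t ht => ?_⟩
  · refine AbsolutelyContinuousOnInterval.of_eq_const_add (C := c 0)
      ((hA T hT).1.absolutelyContinuousOnInterval_intervalIntegral Set.left_mem_uIcc)
      fun x hx => ?_
    rw [Set.uIcc_of_le hT.le] at hx
    exact hA0 x hx.1
  · refine (hB t ht).1.congr_ae ?_
    rw [EventuallyEq, ae_restrict_iff' measurableSet_uIoc]
    filter_upwards [hderiv t ht] with x hx hxt
    rw [hx hxt]
  · rw [← (hB t ht).2]
    refine intervalIntegral.integral_congr_ae ?_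
    filter_upwards [hderiv t ht] with x hx hxt
    rw [hx hxt]

end

/-! ### Comparison, growth and the fractional Gronwall inequality -/

section

lemma intervalIntegrable_fracKernel_mul_continuousOn {α t : ℝ} (hα : 0 < α) (ht : 0 ≤ t)
    {h : ℝ → ℝ} (hh : ContinuousOn h (Set.Ici 0)) :
    IntervalIntegrable (fun s => fracKernel α (t - s) * h s) volume 0 t := by
  have hk : IntervalIntegrable (fun s => fracKernel α (t - s)) volume 0 t := by
    simpa only [fracKernel_one, mul_one] using intervalIntegrable_fracKernel_mul hα one_pos ht
  refine hk.mul_continuousOn (hh.mono ?_)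
  rw [Set.uIcc_of_le ht]
  exact Set.Icc_subset_Ici_self

lemma integral_fracKernel_mul_mono {α t : ℝ} (hα : 0 < α) (ht : 0 ≤ t) {h k : ℝ → ℝ}
    (hh : IntervalIntegrable (fun s => fracKernel α (t - s) * h s) volume 0 t)
    (hk : IntervalIntegrable (fun s => fracKernel α (t - s) * k s) volume 0 t)
    (hle : ∀ s, 0 ≤ s → s ≤ t → h s ≤ k s) :
    ∫ s in (0 : ℝ)..t, fracKernel α (t - s) * h s
      ≤ ∫ s in (0 : ℝ)..t, fracKernel α (t - s) * k s :=
  intervalIntegral.integral_mono_on ht hh hk fun s hs =>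
    mul_le_mul_of_nonneg_left (hle s hs.1 hs.2) (fracKernel_nonneg hα (sub_nonneg.2 hs.2))

lemma HasCaputoDeriv.continuousOn {α : ℝ} {u h : ℝ → ℝ} (hu : HasCaputoDeriv α u h) :
    ContinuousOn u (Set.Ici 0) := by
  intro t ht
  have ht' : (0 : ℝ) ≤ t := ht
  have h1 := (hu.absCont (t + 1) (by linarith)).continuousOn
  rw [Set.uIcc_of_le (by linarith)] at h1
  refine (h1 t ⟨ht, by linarith⟩).mono_of_mem_nhdsWithin ?_
  filter_upwards [self_mem_nhdsWithin, mem_nhdsWithin_of_mem_nhds (Iio_mem_nhds (lt_add_one t))]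
    with x hx hx' using ⟨hx, le_of_lt hx'⟩

/-- Comparison of two functions with the same initial value through their Caputo derivatives. -/
lemma HasCaputoDeriv.sub_le_integral {α : ℝ} (hα₀ : 0 < α) (hα₁ : α < 1) {u u' h h' k : ℝ → ℝ}
    (hu : HasCaputoDeriv α u h) (hu' : HasCaputoDeriv α u' h') (h0 : u 0 = u' 0)
    (hh : ContinuousOn h (Set.Ici 0)) (hh' : ContinuousOn h' (Set.Ici 0))
    (hk : ContinuousOn k (Set.Ici 0)) (hle : ∀ s, 0 ≤ s → h s - h' s ≤ k s) {t : ℝ} (ht : 0 ≤ t) :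
    u t - u' t ≤ ∫ s in (0 : ℝ)..t, fracKernel α (t - s) * k s := by
  rw [hu.eq_add_integral hα₀ hα₁ ht, hu'.eq_add_integral hα₀ hα₁ ht, h0, add_sub_add_left_eq_sub,
    ← intervalIntegral.integral_sub (intervalIntegrable_fracKernel_mul_continuousOn hα₀ ht hh)
      (intervalIntegrable_fracKernel_mul_continuousOn hα₀ ht hh')]
  simp only [← mul_sub]
  exact integral_fracKernel_mul_mono hα₀ ht
    (intervalIntegrable_fracKernel_mul_continuousOn hα₀ ht (hh.sub hh'))
    (intervalIntegrable_fracKernel_mul_continuousOn hα₀ ht hk) fun s hs _ => hle s hs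

lemma HasCaputoDeriv.eq_initial {α : ℝ} (hα₀ : 0 < α) (hα₁ : α < 1) {u h : ℝ → ℝ}
    (hu : HasCaputoDeriv α u h) (hh : ∀ s, 0 ≤ s → h s = 0) {t : ℝ} (ht : 0 ≤ t) : u t = u 0 := by
  rw [hu.eq_add_integral hα₀ hα₁ ht, intervalIntegral.integral_congr (g := fun _ => (0 : ℝ))]
  · simp
  · intro s hs
    rw [Set.uIcc_of_le ht] at hs
    simp [hh s hs.1]

/-- Growth forced by a Caputo derivative that is eventually bounded below. -/
lemma HasCaputoDeriv.add_le {α : ℝ} (hα₀ : 0 < α) (hα₁ : α < 1) {u h : ℝ → ℝ}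
    (hu : HasCaputoDeriv α u h) (hh : ContinuousOn h (Set.Ici 0)) (hpos : ∀ s, 0 ≤ s → 0 ≤ h s)
    {c T t : ℝ} (hT : 0 ≤ T) (hc : ∀ s, T ≤ s → c ≤ h s) (ht : 0 ≤ t) :
    u 0 + c * posKernel (α + 1) (t - T) ≤ u t := by
  -- The kernel of order `α + 1` is written as the fractional integral of the unit step at `T`, so
  -- that both sides are integrals against the same kernel and only `c · 1_{s > T} ≤ h` remains.
  rw [hu.eq_add_integral hα₀ hα₁ ht, ← integral_posKernel_mul_indicator ht,
    ← integral_posKernel_mul_posKernel hα₀ one_pos, ← integral_const_mul]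
  refine add_le_add_right (integral_mono
    ((integrable_posKernel_mul_posKernel hα₀ one_pos t T).const_mul c)
    ((integrable_posKernel_mul_indicator_iff ht h).2
      (intervalIntegrable_fracKernel_mul_continuousOn hα₀ ht hh)) fun s => ?_) _
  have hk := posKernel_nonneg hα₀ (t - s)
  have h1 : c * posKernel 1 (s - T) ≤ (Set.Ioi 0).indicator h s := by
    rcases le_or_gt s T with hs | hs
    · rw [posKernel_of_nonpos (by linarith), mul_zero]
      exact Set.indicator_nonneg (fun s hs => hpos s (le_of_lt hs)) s
    · rw [posKernel_of_pos (by linarith), fracKernel_one, mul_one,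
        Set.indicator_of_mem (Set.mem_Ioi.2 (by linarith))]
      exact hc s hs.le
  calc c * (posKernel α (t - s) * posKernel 1 (s - T))
      = posKernel α (t - s) * (c * posKernel 1 (s - T)) := by ring
    _ ≤ _ := mul_le_mul_of_nonneg_left h1 hk

lemma HasCaputoDeriv.initial_le {α : ℝ} (hα₀ : 0 < α) (hα₁ : α < 1) {u h : ℝ → ℝ}
    (hu : HasCaputoDeriv α u h) (hh : ContinuousOn h (Set.Ici 0)) (hpos : ∀ s, 0 ≤ s → 0 ≤ h s)
    {t : ℝ} (ht : 0 ≤ t) : u 0 ≤ u t := by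
  simpa using hu.add_le hα₀ hα₁ hh hpos le_rfl hpos ht

lemma HasCaputoDeriv.tendsto_atTop {α : ℝ} (hα₀ : 0 < α) (hα₁ : α < 1) {u h : ℝ → ℝ}
    (hu : HasCaputoDeriv α u h) (hh : ContinuousOn h (Set.Ici 0)) (hpos : ∀ s, 0 ≤ s → 0 ≤ h s)
    {c T : ℝ} (hc0 : 0 < c) (hT : 0 ≤ T) (hc : ∀ s, T ≤ s → c ≤ h s) :
    Tendsto u atTop atTop := by
  have h1 : Tendsto (fun t : ℝ => (t - T) ^ α) atTop atTop :=
    (tendsto_rpow_atTop hα₀).comp (tendsto_atTop_add_const_right _ (-T) tendsto_id)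
  have h2 := tendsto_atTop_add_const_left _ (u 0)
    ((h1.atTop_div_const (Real.Gamma_pos_of_pos (s := α + 1) (by positivity))).const_mul_atTop hc0)
  refine tendsto_atTop_mono' _ ?_ h2
  filter_upwards [eventually_gt_atTop T] with t ht
  have := hu.add_le hα₀ hα₁ hh hpos hT hc (hT.trans ht.le)
  rwa [posKernel_of_pos (sub_pos.2 ht), fracKernel, add_sub_cancel_right] at this

variable {ι : Type*} [Fintype ι]

lemma ContinuousOn.mulVec_apply {s : Set ℝ} {z : ℝ → ι → ℝ}
    (hz : ∀ i, ContinuousOn (fun t => z t i) s) (B : Matrix ι ι ℝ) (i : ι) :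
    ContinuousOn (fun t => (B *ᵥ z t) i) s := by
  simp only [Matrix.mulVec, dotProduct]
  exact continuousOn_finsetSum _ fun j _ => (hz j).const_mul _

lemma mulVec_apply_nonneg {B : Matrix ι ι ℝ} (hB : ∀ i j, 0 ≤ B i j) {z : ι → ℝ}
    (hz : ∀ j, 0 ≤ z j) (i : ι) : 0 ≤ (B *ᵥ z) i :=
  Finset.sum_nonneg fun j _ => mul_nonneg (hB i j) (hz j)

/-- Fractional Gronwall inequality for nonnegative matrices. -/
theorem nonpos_of_le_integral {α : ℝ} (hα : 0 < α) {B : Matrix ι ι ℝ} (hB : ∀ i j, 0 ≤ B i j)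
    {z : ℝ → ι → ℝ} (hz : ∀ i, ContinuousOn (fun t => z t i) (Set.Ici 0))
    (H : ∀ t, 0 ≤ t → ∀ i, z t i ≤ 0 ∨
      z t i ≤ ∫ s in (0 : ℝ)..t, fracKernel α (t - s) * (B *ᵥ z s) i)
    {t : ℝ} (ht : 0 ≤ t) (i : ι) : z t i ≤ 0 := by
  obtain ⟨M, hM0, hM⟩ : ∃ M : ℝ, 0 ≤ M ∧ ∀ s ∈ Set.Icc 0 t, ∀ i, z s i ≤ M := by
    have : ∀ i, ∃ C : ℝ, ∀ s ∈ Set.Icc 0 t, ‖z s i‖ ≤ C := fun i =>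
      isCompact_Icc.exists_bound_of_continuousOn ((hz i).mono Set.Icc_subset_Ici_self)
    choose C hC using this
    refine ⟨∑ i, |C i|, Finset.sum_nonneg fun i _ => abs_nonneg _, fun s hs i => ?_⟩
    calc z s i ≤ ‖z s i‖ := le_abs_self _
      _ ≤ |C i| := (hC i s hs).trans (le_abs_self _)
      _ ≤ _ := Finset.single_le_sum (f := fun i => |C i|) (fun i _ => abs_nonneg _)
          (Finset.mem_univ i)
  set K : ℝ := ∑ i, ∑ j, B i j with hK
  have hK0 : 0 ≤ K := Finset.sum_nonneg fun i _ => Finset.sum_nonneg fun j _ => hB i j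
  have hrow : ∀ i, ∑ j, B i j ≤ K := fun i =>
    Finset.single_le_sum (f := fun i => ∑ j, B i j)
      (fun i _ => Finset.sum_nonneg fun j _ => hB i j) (Finset.mem_univ i)
  -- Only upper bounds are propagated, which is enough because `B ≥ 0`. Each pass through the
  -- integral raises the kernel order by `α` and costs a factor `K`. The alternative `z t i ≤ 0` in
  -- `H` serves coordinates without an integral inequality, such as saturated ones.
  have step : ∀ n : ℕ, ∀ s ∈ Set.Icc 0 t, ∀ i, z s i ≤ M * K ^ n * fracKernel (α * n + 1) s := by
    intro n
    induction n with
    | zero => simpa [fracKernel_one] using hM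
    | succ n ih =>
      intro s hs i
      have hb : 0 < α * n + 1 := by positivity
      rcases H s hs.1 i with h | h
      · exact h.trans (mul_nonneg (by positivity) (fracKernel_nonneg (by positivity) hs.1))
      rcases hs.1.eq_or_lt with h0 | h0
      · subst h0
        refine h.trans ?_
        simpa using mul_nonneg (mul_nonneg hM0 (pow_nonneg hK0 (n + 1)))
          (fracKernel_nonneg (by positivity) le_rfl)
      refine h.trans ((integral_fracKernel_mul_mono hα hs.1
        (k := fun r => M * K ^ (n + 1) * fracKernel (α * n + 1) r)
        (intervalIntegrable_fracKernel_mul_continuousOn hα hs.1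
          (ContinuousOn.mulVec_apply hz B i)) ?_ fun r hr hrs => ?_).trans_eq ?_)
      · refine ((intervalIntegrable_fracKernel_mul hα hb hs.1).const_mul
          (M * K ^ (n + 1))).congr fun r _ => ?_
        ring
      · have hφ := fracKernel_nonneg hb hr
        calc (B *ᵥ z r) i ≤ ∑ j, B i j * (M * K ^ n * fracKernel (α * n + 1) r) :=
              Finset.sum_le_sum fun j _ =>
                mul_le_mul_of_nonneg_left (ih r ⟨hr, hrs.trans hs.2⟩ j) (hB i j)
          _ = (∑ j, B i j) * (M * K ^ n * fracKernel (α * n + 1) r) := by rw [Finset.sum_mul]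
          _ ≤ K * (M * K ^ n * fracKernel (α * n + 1) r) :=
              mul_le_mul_of_nonneg_right (hrow i) (by positivity)
          _ = _ := by ring
      · have e : ∀ r, fracKernel α (s - r) * (M * K ^ (n + 1) * fracKernel (α * n + 1) r)
            = M * K ^ (n + 1) * (fracKernel α (s - r) * fracKernel (α * n + 1) r) :=
          fun r => by ring
        simp only [e]
        rw [intervalIntegral.integral_const_mul, integral_fracKernel_mul hα hb h0]
        congr 2
        push_cast; ring
  have hlim : Tendsto (fun n : ℕ => M * K ^ n * fracKernel (α * n + 1) t) atTop (𝓝 0) := by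
    refine (summable_mul_fracKernel hα hK0 (c := fun n => M * K ^ n) (C := M)
      (fun k => ?_) ht).tendsto_atTop_zero
    rw [abs_of_nonneg (by positivity)]
  exact ge_of_tendsto hlim (Eventually.of_forall fun n => step n t ⟨ht, le_rfl⟩ i)

end

/-! ### Coefficients and convergence of the two series -/

section

variable {ι : Type*} [Fintype ι] [DecidableEq ι]

lemma gFun_of_lt {w : ℝ} (hw : w < 1) : gFun w = ((-Real.log (1 - w) : ℝ) : EReal) := if_pos hw

lemma gFun_one : gFun 1 = ⊤ := if_neg (lt_irrefl 1)

lemma gFun_nonneg {w : ℝ} (hw : w ∈ Set.Icc (0 : ℝ) 1) : 0 ≤ gFun w := by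
  rcases hw.2.lt_or_eq with h | h
  · rw [gFun_of_lt h]
    exact_mod_cast neg_nonneg.2 (Real.log_nonpos (by linarith) (by linarith [hw.1]))
  · simp [h, gFun_one]

lemma hatMatrix_apply (A : Matrix ι ι ℝ) (w₀ : ι → ℝ) (i j : ι) :
    hatMatrix A w₀ i j = A i j * (1 - w₀ j) := Matrix.mul_diagonal ..

lemma hatMatrix_nonneg {A : Matrix ι ι ℝ} (hA : ∀ i j, 0 ≤ A i j) {w₀ : ι → ℝ}
    (hw₀ : ∀ i, w₀ i ∈ Set.Icc (0 : ℝ) 1) (i j : ι) : 0 ≤ hatMatrix A w₀ i j := by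
  rw [hatMatrix_apply]
  exact mul_nonneg (hA i j) (sub_nonneg.2 (hw₀ j).2)

lemma abs_pow_mulVec_le (M : Matrix ι ι ℝ) (v : ι → ℝ) (k : ℕ) (i : ι) :
    |(M ^ k *ᵥ v) i| ≤ ‖v‖ * (∑ i, ∑ j, |M i j|) ^ k := by
  induction k generalizing i with
  | zero => simpa using norm_le_pi_norm v i
  | succ k ih =>
    rw [pow_succ', ← Matrix.mulVec_mulVec]
    set x := M ^ k *ᵥ v
    set K := ∑ i, ∑ j, |M i j| with hK
    have hrow : ∑ j, |M i j| ≤ K :=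
      Finset.single_le_sum (f := fun i => ∑ j, |M i j|)
        (fun i _ => Finset.sum_nonneg fun j _ => abs_nonneg _) (Finset.mem_univ i)
    have hK0 : 0 ≤ K := (Finset.sum_nonneg fun j _ => abs_nonneg _).trans hrow
    calc |(M *ᵥ x) i| ≤ ∑ j, |M i j * x j| := Finset.abs_sum_le_sum_abs _ _
      _ ≤ ∑ j, |M i j| * (‖v‖ * K ^ k) := Finset.sum_le_sum fun j _ => by
          rw [abs_mul]; exact mul_le_mul_of_nonneg_left (ih j) (abs_nonneg _)
      _ = (∑ j, |M i j|) * (‖v‖ * K ^ k) := by rw [Finset.sum_mul]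
      _ ≤ K * (‖v‖ * K ^ k) := by gcongr
      _ = _ := by ring

lemma pow_apply_eq_mulVec (M : Matrix ι ι ℝ) (k : ℕ) (i j : ι) :
    (M ^ k) i j = (M ^ k *ᵥ Pi.single j 1) i := by
  rw [Matrix.mulVec_single_one, Matrix.col_apply]

lemma summable_mittagLefflerTerm {α : ℝ} (hα : 0 < α) (M : Matrix ι ι ℝ) :
    Summable (mittagLefflerTerm α M) := by
  refine Pi.summable.2 fun i => Pi.summable.2 fun j => ?_
  set K := ∑ i, ∑ j, |M i j| with hK
  have hK0 : 0 ≤ K := Finset.sum_nonneg fun i _ => Finset.sum_nonneg fun j _ => abs_nonneg _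
  refine (summable_mul_fracKernel hα (c := fun k => (M ^ k) i j)
    (C := ‖(Pi.single j 1 : ι → ℝ)‖) hK0 (fun k => ?_)
    zero_le_one).congr fun k => ?_
  · rw [pow_apply_eq_mulVec]; exact abs_pow_mulVec_le M _ k i
  · simp [mittagLefflerTerm, fracKernel, mul_comm]

lemma mul_rpow_mul_natCast {α β t : ℝ} (hβ : 0 < β) (ht : 0 ≤ t) (k : ℕ) :
    (β * t) ^ (α * k) = (β ^ α) ^ k * t ^ (α * k) := by
  rw [Real.mul_rpow hβ.le ht, Real.rpow_mul hβ.le, Real.rpow_natCast]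

/-- Coefficients of the series solution of the linearized system. -/
def lteCoeff (α β : ℝ) (A : Matrix ι ι ℝ) (w₀ : ι → ℝ) : ℕ → ι → ℝ
  | 0 => fun i => (gFun (w₀ i)).toReal
  | k + 1 => (β ^ α) ^ (k + 1) • (hatMatrix A w₀ ^ (k + 1) *ᵥ (fun i => (gFun (w₀ i)).toReal)
      + (hatMatrix A w₀ ^ k * A) *ᵥ fun j => bFun (w₀ j))

/-- The linearized equation read off on coefficients: differentiation shifts the index, and the
constant forcing contributes only to the term of index `0`. -/
lemma lteCoeff_succ (α β : ℝ) (A : Matrix ι ι ℝ) (w₀ : ι → ℝ) (k : ℕ) :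
    lteCoeff α β A w₀ (k + 1) = β ^ α • (hatMatrix A w₀ *ᵥ lteCoeff α β A w₀ k)
      + if k = 0 then β ^ α • (A *ᵥ fun j => bFun (w₀ j)) else 0 := by
  cases k with
  | zero => simp [lteCoeff, smul_add]
  | succ k =>
    simp only [lteCoeff, Nat.succ_ne_zero, if_false, add_zero, Matrix.mulVec_smul,
      Matrix.mulVec_add, Matrix.mulVec_mulVec, smul_smul, ← pow_succ', ← mul_assoc]

/-- The `+ 1` in the ratio absorbs the forcing term of the recursion, which is at most `C R^k`. -/
lemma abs_lteCoeff_le {α β : ℝ} (hβ : 0 < β) (A : Matrix ι ι ℝ) (w₀ : ι → ℝ) (k : ℕ) (i : ι) :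
    |lteCoeff α β A w₀ k i|
      ≤ (‖lteCoeff α β A w₀ 0‖ + β ^ α * ‖A *ᵥ fun j => bFun (w₀ j)‖)
        * (β ^ α * (∑ i, ∑ j, |hatMatrix A w₀ i j|) + 1) ^ k := by
  set v := A *ᵥ fun j => bFun (w₀ j) with hv
  set K := ∑ i, ∑ j, |hatMatrix A w₀ i j| with hK
  set C := ‖lteCoeff α β A w₀ 0‖ + β ^ α * ‖v‖ with hC
  have hb : 0 ≤ β ^ α := by positivity
  have hC0 : 0 ≤ C := by positivity
  have hrow : ∀ i, ∑ j, |hatMatrix A w₀ i j| ≤ K := fun i =>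
    Finset.single_le_sum (f := fun i => ∑ j, |hatMatrix A w₀ i j|)
      (fun i _ => Finset.sum_nonneg fun j _ => abs_nonneg _) (Finset.mem_univ i)
  have hK0 : 0 ≤ K := (Finset.sum_nonneg fun j _ => abs_nonneg _).trans (hrow i)
  induction k generalizing i with
  | zero =>
    simp only [pow_zero, mul_one]
    exact (norm_le_pi_norm (lteCoeff α β A w₀ 0) i).trans
      (le_add_of_nonneg_right (by positivity))
  | succ k ih =>
    set R := β ^ α * K + 1 with hR
    have hR1 : 1 ≤ R := by rw [hR]; linarith [mul_nonneg hb hK0]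
    have h1 : |(hatMatrix A w₀ *ᵥ lteCoeff α β A w₀ k) i| ≤ K * (C * R ^ k) := by
      calc _ ≤ ∑ j, |hatMatrix A w₀ i j * lteCoeff α β A w₀ k j| :=
            Finset.abs_sum_le_sum_abs _ _
        _ ≤ ∑ j, |hatMatrix A w₀ i j| * (C * R ^ k) := Finset.sum_le_sum fun j _ => by
            rw [abs_mul]; exact mul_le_mul_of_nonneg_left (ih j) (abs_nonneg _)
        _ = (∑ j, |hatMatrix A w₀ i j|) * (C * R ^ k) := by rw [Finset.sum_mul]
        _ ≤ _ := mul_le_mul_of_nonneg_right (hrow i) (by positivity)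
    have h2 : |(if k = 0 then β ^ α • v else 0 : ι → ℝ) i| ≤ C * R ^ k := by
      split_ifs with h
      · rw [h, pow_zero, mul_one, Pi.smul_apply, smul_eq_mul, abs_mul, abs_of_nonneg hb]
        exact (mul_le_mul_of_nonneg_left (norm_le_pi_norm v i) hb).trans
          (le_add_of_nonneg_left (norm_nonneg _))
      · simp only [Pi.zero_apply, abs_zero]; positivity
    rw [lteCoeff_succ, Pi.add_apply, Pi.smul_apply, smul_eq_mul]
    calc _ ≤ |β ^ α * (hatMatrix A w₀ *ᵥ lteCoeff α β A w₀ k) i| + C * R ^ k :=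
          (abs_add_le _ _).trans (add_le_add_right h2 _)
      _ ≤ β ^ α * (K * (C * R ^ k)) + C * R ^ k := by
          rw [abs_mul, abs_of_nonneg hb]; gcongr
      _ = _ := by rw [pow_succ, hR]; ring

lemma hasSum_fracSeries {α : ℝ} (hα : 0 < α) {c : ℕ → ℝ} {C R : ℝ} (hR : 0 ≤ R)
    (hc : ∀ k, |c k| ≤ C * R ^ k) {t : ℝ} (ht : 0 ≤ t) :
    HasSum (fun k : ℕ => c k * fracKernel (α * k + 1) t) (fracSeries α c t) :=
  (summable_mul_fracKernel hα hR hc ht).hasSum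

lemma forcingTerm_eq {α β : ℝ} (hβ : 0 < β) (A : Matrix ι ι ℝ) (w₀ : ι → ℝ) {t : ℝ} (ht : 0 ≤ t)
    (n : ℕ) (i : ι) : forcingTerm α β A w₀ t n i
      = (β ^ α) ^ (n + 1) * ((hatMatrix A w₀ ^ n * A) *ᵥ fun j => bFun (w₀ j)) i
        * fracKernel (α * (n + 1 : ℕ) + 1) t := by
  have := mul_rpow_mul_natCast (α := α) hβ ht (n + 1)
  push_cast at this
  simp only [forcingTerm, Pi.smul_apply, smul_eq_mul, this, fracKernel]
  push_cast
  rw [add_sub_cancel_right]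
  ring

lemma summable_forcingTerm {α β : ℝ} (hα : 0 < α) (hβ : 0 < β) (A : Matrix ι ι ℝ) (w₀ : ι → ℝ)
    {t : ℝ} (ht : 0 ≤ t) : Summable (forcingTerm α β A w₀ t) := by
  refine Pi.summable.2 fun i => ?_
  simp only [forcingTerm_eq hβ A w₀ ht, ← Matrix.mulVec_mulVec]
  set v := A *ᵥ fun j => bFun (w₀ j)
  have hb : 0 ≤ β ^ α := by positivity
  set R := (β ^ α + 1) * ((∑ i, ∑ j, |hatMatrix A w₀ i j|) + 1) with hR
  have hK : 0 ≤ ∑ i, ∑ j, |hatMatrix A w₀ i j| :=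
    Finset.sum_nonneg fun i _ => Finset.sum_nonneg fun j _ => abs_nonneg _
  have hR0 : 0 ≤ R := by positivity
  -- The shift brings the kernels to order `αn + 1`; the truncated `n - 1` merely adds one harmless
  -- term at `n = 0`. The `+ 1` beside the entry sum in `R` allows the power `k - 1` to be raised to
  -- `k`.
  refine (summable_nat_add_iff 1 (f := fun n : ℕ => (β ^ α) ^ n * (hatMatrix A w₀ ^ (n - 1) *ᵥ v) i
    * fracKernel (α * n + 1) t)).2
    (summable_mul_fracKernel hα hR0 (C := ‖v‖) (fun k => ?_) ht)
  rw [abs_mul, abs_of_nonneg (pow_nonneg hb k), hR, mul_pow, mul_left_comm]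
  refine mul_le_mul (pow_le_pow_left₀ hb (by linarith) k)
    ((abs_pow_mulVec_le _ v (k - 1) i).trans (mul_le_mul_of_nonneg_left ?_ (norm_nonneg _)))
    (abs_nonneg _) (by positivity)
  calc _ ≤ ((∑ i, ∑ j, |hatMatrix A w₀ i j|) + 1) ^ (k - 1) :=
        pow_le_pow_left₀ hK (by linarith) _
    _ ≤ _ := pow_le_pow_right₀ (by linarith) (Nat.sub_le k 1)

end

/-! ### The linearized system: existence and uniqueness -/

section

variable {ι : Type*} [Fintype ι] [DecidableEq ι]

lemma hatMatrix_apply_eq_zero (A : Matrix ι ι ℝ) {w₀ : ι → ℝ} {j : ι} (hj : w₀ j = 1) (i : ι) :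
    hatMatrix A w₀ i j = 0 := by simp [hatMatrix_apply, hj]

/-- A saturated node has a zero column in `Â`, so its infinite value never reaches another
coordinate through the series. -/
lemma pow_hatMatrix_apply (A : Matrix ι ι ℝ) {w₀ : ι → ℝ} {i j : ι} (hj : w₀ j = 1) (hij : i ≠ j)
    (k : ℕ) : (hatMatrix A w₀ ^ k) i j = 0 := by
  cases k with
  | zero => simp [hij]
  | succ k => simp [pow_succ, Matrix.mul_apply, hatMatrix_apply_eq_zero A hj]

lemma pow_apply_nonneg {M : Matrix ι ι ℝ} (hM : ∀ i j, 0 ≤ M i j) (k : ℕ) (i j : ι) :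
    0 ≤ (M ^ k) i j := by
  induction k generalizing i j with
  | zero => rw [pow_zero, Matrix.one_apply]; split_ifs <;> simp
  | succ k ih =>
    rw [pow_succ, Matrix.mul_apply]
    exact Finset.sum_nonneg fun l _ => mul_nonneg (ih i l) (hM l j)

lemma hasSum_mittagLeffler_apply {α β : ℝ} (hα : 0 < α) (hβ : 0 < β) (M : Matrix ι ι ℝ) {t : ℝ}
    (ht : 0 ≤ t) (i j : ι) :
    HasSum (fun k : ℕ => (β ^ α) ^ k * (M ^ k) i j * fracKernel (α * k + 1) t)
      (mittagLeffler α ((β * t) ^ α • M) i j) := by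
  have hs := (summable_mittagLefflerTerm hα ((β * t) ^ α • M)).hasSum
  refine (Pi.hasSum.1 (Pi.hasSum.1 hs i) j).congr_fun fun k => ?_
  rw [mittagLefflerTerm, smul_pow, ← Real.rpow_natCast ((β * t) ^ α), ← Real.rpow_mul (by positivity),
    mul_rpow_mul_natCast hβ ht, fracKernel, add_sub_cancel_right]
  simp only [Matrix.smul_apply, smul_eq_mul]
  ring

lemma coe_finset_sum_ereal {κ : Type*} (s : Finset κ) (f : κ → ℝ) :
    ((∑ j ∈ s, f j : ℝ) : EReal) = ∑ j ∈ s, (f j : EReal) :=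
  map_sum (⟨⟨Real.toEReal, EReal.coe_zero⟩, EReal.coe_add⟩ : ℝ →+ EReal) f s

/-- Infinite entries of `g(w₀)` meet only zero coefficients in this row, so `0 * ⊤ = 0` agrees with
`EReal.toReal ⊤ = 0`, and the two real series merge term by term. -/
lemma lteSeries_of_lt {α β : ℝ} (hα : 0 < α) (hβ : 0 < β) (A : Matrix ι ι ℝ) {w₀ : ι → ℝ}
    (hw₀ : ∀ i, w₀ i ∈ Set.Icc (0 : ℝ) 1) {i : ι} (hi : w₀ i < 1) {t : ℝ} (ht : 0 ≤ t) :
    lteSeries α β A w₀ t i = (fracSeries α (fun k => lteCoeff α β A w₀ k i) t : EReal) := by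
  have h1 : ∀ j, HasSum (fun k : ℕ => (β ^ α) ^ k * (hatMatrix A w₀ ^ k) i j
      * fracKernel (α * k + 1) t * (gFun (w₀ j)).toReal)
      (mittagLeffler α ((β * t) ^ α • hatMatrix A w₀) i j * (gFun (w₀ j)).toReal) := fun j =>
    (hasSum_mittagLeffler_apply hα hβ _ ht i j).mul_right _
  -- The forcing term `n` carries the power `α(n+1)`, so it is matched with index `k = n + 1`.
  have h2 : HasSum (fun k : ℕ => if k = 0 then 0 else forcingTerm α β A w₀ t (k - 1) i)
      ((∑' n : ℕ, forcingTerm α β A w₀ t n) i) := by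
    rw [← hasSum_nat_add_iff' 1]
    simpa using Pi.hasSum.1 (summable_forcingTerm hα hβ A w₀ ht).hasSum i
  have h3 := (hasSum_sum (s := Finset.univ) fun j _ => h1 j).add h2
  have h4 : fracSeries α (fun k => lteCoeff α β A w₀ k i) t
      = (∑ j, mittagLeffler α ((β * t) ^ α • hatMatrix A w₀) i j * (gFun (w₀ j)).toReal)
        + (∑' n : ℕ, forcingTerm α β A w₀ t n) i := by
    rw [← h3.tsum_eq, fracSeries]
    refine tsum_congr fun k => ?_
    cases k with
    | zero => simp [lteCoeff, Matrix.one_apply, fracKernel_one]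
    | succ k =>
      rw [if_neg (Nat.succ_ne_zero k), Nat.succ_sub_one, forcingTerm_eq hβ A w₀ ht]
      simp only [lteCoeff, Pi.smul_apply, Pi.add_apply, smul_eq_mul, mul_add, add_mul]
      congr 1
      simp only [Matrix.mulVec, dotProduct, Finset.mul_sum, Finset.sum_mul]
      exact Finset.sum_congr rfl fun j _ => by ring
  rw [h4, lteSeries, EReal.coe_add, coe_finset_sum_ereal]
  congr 1
  refine Finset.sum_congr rfl fun j _ => ?_
  rcases (hw₀ j).2.lt_or_eq with hj | hj
  · rw [gFun_of_lt hj, EReal.coe_mul, EReal.toReal_coe]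
  · have hij : i ≠ j := fun h => hi.ne (h ▸ hj)
    have : mittagLeffler α ((β * t) ^ α • hatMatrix A w₀) i j = 0 := by
      rw [← (hasSum_mittagLeffler_apply hα hβ _ ht i j).tsum_eq]
      simp [pow_hatMatrix_apply A hj hij]
    simp [this]

/-- The term `k = 0` makes the diagonal Mittag-Leffler entry positive, so its product with `⊤` is
`⊤`; all other summands are nonnegative and cannot cancel it. -/
lemma lteSeries_of_eq_one {α β : ℝ} (hα : 0 < α) (hβ : 0 < β) {A : Matrix ι ι ℝ}
    (hA : ∀ i j, 0 ≤ A i j) {w₀ : ι → ℝ}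
    (hw₀ : ∀ i, w₀ i ∈ Set.Icc (0 : ℝ) 1) {i : ι} (hi : w₀ i = 1) {t : ℝ} (ht : 0 ≤ t) :
    lteSeries α β A w₀ t i = ⊤ := by
  have hterm : ∀ i j (k : ℕ), 0 ≤ (β ^ α) ^ k * (hatMatrix A w₀ ^ k) i j
      * fracKernel (α * k + 1) t := fun i j k =>
    mul_nonneg (mul_nonneg (by positivity) (pow_apply_nonneg (hatMatrix_nonneg hA hw₀) k i j))
      (fracKernel_nonneg (by positivity) ht)
  have hE : ∀ j, 0 ≤ mittagLeffler α ((β * t) ^ α • hatMatrix A w₀) i j := fun j =>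
    (hasSum_mittagLeffler_apply hα hβ _ ht i j).nonneg (hterm i j)
  have hEi : 0 < mittagLeffler α ((β * t) ^ α • hatMatrix A w₀) i i := by
    have := le_hasSum (hasSum_mittagLeffler_apply hα hβ (hatMatrix A w₀) ht i i) 0
      fun k _ => hterm i i k
    simp only [pow_zero, Matrix.one_apply_eq, CharP.cast_eq_zero, mul_zero, zero_add,
      fracKernel_one, mul_one] at this
    linarith
  have hsum : (∑ j, ((mittagLeffler α ((β * t) ^ α • hatMatrix A w₀) i j : ℝ) : EReal)
      * gFun (w₀ j)) = ⊤ := by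
    refine top_le_iff.1 ?_
    refine le_trans (le_of_eq ?_) (Finset.single_le_sum (f := fun j =>
      ((mittagLeffler α ((β * t) ^ α • hatMatrix A w₀) i j : ℝ) : EReal) * gFun (w₀ j))
      (fun j _ => mul_nonneg (by exact_mod_cast hE j) (gFun_nonneg (hw₀ j)))
      (Finset.mem_univ i))
    simp only [hi, gFun_one]
    exact (EReal.coe_mul_top_of_pos hEi).symm
  rw [lteSeries, hsum, EReal.top_add_coe]

lemma hasCaputoDerivExt_of_eq_top {α : ℝ} {y : ℝ → EReal} {h : ℝ → ℝ}
    (hy : HasCaputoDerivExt α y h) (h0 : y 0 = ⊤) {t : ℝ} (ht : 0 ≤ t) : y t = ⊤ := by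
  rcases hy with hy | hy
  · exact hy t ht
  · exact absurd h0 (hy.1 0 le_rfl).1

lemma HasCaputoDerivExt.finite {α : ℝ} {y : ℝ → EReal} {h : ℝ → ℝ}
    (hy : HasCaputoDerivExt α y h) (h0 : y 0 ≠ ⊤) :
    (∀ t : ℝ, 0 ≤ t → y t = ((y t).toReal : EReal)) ∧
      HasCaputoDeriv α (fun t => (y t).toReal) h := by
  rcases hy with hy | hy
  · exact absurd (hy 0 le_rfl) h0
  · exact ⟨fun t ht => (EReal.coe_toReal (hy.1 t ht).1 (hy.1 t ht).2).symm, hy.2⟩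

variable {α β : ℝ} {A : Matrix ι ι ℝ} {w₀ : ι → ℝ} {y y' : ℝ → ι → EReal}

lemma IsLTESolution.eq_top (hy : IsLTESolution α β A w₀ y) {i : ι} (hi : w₀ i = 1) {t : ℝ}
    (ht : 0 ≤ t) : y t i = ⊤ :=
  hasCaputoDerivExt_of_eq_top (hy.equation i) (by simp [hy.initial, hi, gFun_one]) ht

lemma IsLTESolution.finite (hy : IsLTESolution α β A w₀ y) {i : ι} (hi : w₀ i < 1) :
    (∀ t : ℝ, 0 ≤ t → y t i = ((y t i).toReal : EReal)) ∧
      HasCaputoDeriv α (fun t => (y t i).toReal)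
        (fun t => β ^ α * (hatMatrix A w₀ *ᵥ fun j => (y t j).toReal) i
          + β ^ α * (A *ᵥ fun j => bFun (w₀ j)) i) :=
  (hy.equation i).finite (by simp only [hy.initial, gFun_of_lt hi]; exact EReal.coe_ne_top _)

lemma IsLTESolution.toReal_zero (hy : IsLTESolution α β A w₀ y) (i : ι) :
    (y 0 i).toReal = (gFun (w₀ i)).toReal := by rw [hy.initial]

lemma IsLTESolution.continuousOn (hw₀ : ∀ i, w₀ i ∈ Set.Icc (0 : ℝ) 1)
    (hy : IsLTESolution α β A w₀ y) (i : ι) :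
    ContinuousOn (fun t => (y t i).toReal) (Set.Ici 0) := by
  rcases (hw₀ i).2.lt_or_eq with hi | hi
  · exact (hy.finite hi).2.continuousOn
  · exact (continuousOn_const (c := (0 : ℝ))).congr fun t ht => by
      simp [hy.eq_top hi (show 0 ≤ t from ht)]

lemma IsLTESolution.continuousOn_deriv (hw₀ : ∀ i, w₀ i ∈ Set.Icc (0 : ℝ) 1)
    (hy : IsLTESolution α β A w₀ y) (i : ι) :
    ContinuousOn (fun t => β ^ α * (hatMatrix A w₀ *ᵥ fun j => (y t j).toReal) i
          + β ^ α * (A *ᵥ fun j => bFun (w₀ j)) i) (Set.Ici 0) :=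
  ((ContinuousOn.mulVec_apply (z := fun t j => (y t j).toReal) (fun j => hy.continuousOn hw₀ j)
    (hatMatrix A w₀) i).const_mul _).add continuousOn_const

/-- The forcing cancels in the difference, which satisfies the homogeneous Volterra equation to
which Gronwall applies. Exchanging the two solutions gives uniqueness. -/
lemma IsLTESolution.toReal_le (hα₀ : 0 < α) (hα₁ : α < 1) (hβ : 0 < β) (hA : ∀ i j, 0 ≤ A i j)
    (hw₀ : ∀ i, w₀ i ∈ Set.Icc (0 : ℝ) 1) (hy : IsLTESolution α β A w₀ y)
    (hy' : IsLTESolution α β A w₀ y') {t : ℝ} (ht : 0 ≤ t) (i : ι) :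
    (y t i).toReal ≤ (y' t i).toReal := by
  have hz : ∀ i, ContinuousOn (fun t => (y t i).toReal - (y' t i).toReal) (Set.Ici 0) := fun i =>
    (hy.continuousOn hw₀ i).sub (hy'.continuousOn hw₀ i)
  refine sub_nonpos.1 (nonpos_of_le_integral hα₀ (B := β ^ α • hatMatrix A w₀)
    (z := fun t i => (y t i).toReal - (y' t i).toReal)
    (fun i j => mul_nonneg (by positivity) (hatMatrix_nonneg hA hw₀ i j)) hz
    (fun t ht i => ?_) ht i)
  rcases (hw₀ i).2.lt_or_eq with hi | hi
  · refine Or.inr ((hy.finite hi).2.sub_le_integral hα₀ hα₁ (hy'.finite hi).2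
      ((hy.toReal_zero i).trans (hy'.toReal_zero i).symm) (hy.continuousOn_deriv hw₀ i)
      (hy'.continuousOn_deriv hw₀ i) (ContinuousOn.mulVec_apply hz _ i) (fun s _ => ?_) ht)
    rw [Matrix.smul_mulVec, Pi.smul_apply, smul_eq_mul, add_sub_add_right_eq_sub, ← mul_sub]
    refine le_of_eq (congrArg _ ?_)
    rw [← Pi.sub_apply, ← Matrix.mulVec_sub]
    rfl
  · left; simp [hy.eq_top hi ht, hy'.eq_top hi ht]

lemma IsLTESolution.unique (hα₀ : 0 < α) (hα₁ : α < 1) (hβ : 0 < β) (hA : ∀ i j, 0 ≤ A i j)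
    (hw₀ : ∀ i, w₀ i ∈ Set.Icc (0 : ℝ) 1) (hy : IsLTESolution α β A w₀ y)
    (hy' : IsLTESolution α β A w₀ y') {t : ℝ} (ht : 0 ≤ t) : y t = y' t := by
  ext i
  rcases (hw₀ i).2.lt_or_eq with hi | hi
  · rw [(hy.finite hi).1 t ht, (hy'.finite hi).1 t ht,
      (hy.toReal_le hα₀ hα₁ hβ hA hw₀ hy' ht i).antisymm
        (hy'.toReal_le hα₀ hα₁ hβ hA hw₀ hy ht i)]
  · rw [hy.eq_top hi ht, hy'.eq_top hi ht]

/-- Negative times are unconstrained, so agreement with the series is asked only on `[0, ∞)`; this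
makes the final characterization an equivalence. -/
lemma isLTESolution_of_eq_lteSeries (hα₀ : 0 < α) (hα₁ : α < 1) (hβ : 0 < β)
    (hA : ∀ i j, 0 ≤ A i j) (hw₀ : ∀ i, w₀ i ∈ Set.Icc (0 : ℝ) 1)
    (hy : ∀ t, 0 ≤ t → y t = lteSeries α β A w₀ t) : IsLTESolution α β A w₀ y := by
  have htop : ∀ i, w₀ i = 1 → ∀ t, 0 ≤ t → y t i = ⊤ := fun i hi t ht => by
    rw [hy t ht, lteSeries_of_eq_one hα₀ hβ hA hw₀ hi ht]
  have hfin : ∀ i, w₀ i < 1 → ∀ t, 0 ≤ t →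
      y t i = (fracSeries α (fun k => lteCoeff α β A w₀ k i) t : EReal) := fun i hi t ht => by
    rw [hy t ht, lteSeries_of_lt hα₀ hβ A hw₀ hi ht]
  set R := β ^ α * (∑ i, ∑ j, |hatMatrix A w₀ i j|) + 1 with hR
  have hR0 : 0 ≤ R := by
    have : 0 ≤ ∑ i, ∑ j, |hatMatrix A w₀ i j| :=
      Finset.sum_nonneg fun i _ => Finset.sum_nonneg fun j _ => abs_nonneg _
    positivity
  have hc := abs_lteCoeff_le (α := α) hβ A w₀
  refine ⟨?_, fun i => ?_⟩
  · ext i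
    rcases (hw₀ i).2.lt_or_eq with hi | hi
    · rw [hfin i hi 0 le_rfl, fracSeries_zero hα₀, gFun_of_lt hi]; simp [lteCoeff, gFun_of_lt hi]
    · rw [htop i hi 0 le_rfl, hi, gFun_one]
  rcases (hw₀ i).2.lt_or_eq with hi | hi
  swap
  · exact Or.inl (htop i hi)
  refine Or.inr ⟨fun t ht => ?_, ?_⟩
  · simp only [hfin i hi t ht]
    exact ⟨EReal.coe_ne_top _, EReal.coe_ne_bot _⟩
  refine (hasCaputoDeriv_fracSeries hα₀ hα₁ hR0 fun k => hc k i).congr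
    (fun t ht => by simp only [hfin i hi t ht, EReal.toReal_coe]) fun t ht => ?_
  have h1 : HasSum (fun k : ℕ => ∑ j, hatMatrix A w₀ i j *
      (lteCoeff α β A w₀ k j * fracKernel (α * k + 1) t))
      ((hatMatrix A w₀ *ᵥ fun j => (y t j).toReal) i) := by
    refine hasSum_sum fun j _ => ?_
    rcases (hw₀ j).2.lt_or_eq with hj | hj
    · simp only [hfin j hj t ht.le, EReal.toReal_coe]
      exact (hasSum_fracSeries hα₀ hR0 (fun k => hc k j) ht.le).mul_left _
    · simp only [hatMatrix_apply_eq_zero A hj, zero_mul]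
      exact hasSum_zero
  have h2 := (h1.mul_left (β ^ α)).add
    (hasSum_ite_eq (0 : ℕ) (β ^ α * (A *ᵥ fun j => bFun (w₀ j)) i))
  rw [← h2.tsum_eq, fracSeries]
  refine tsum_congr fun k => ?_
  rw [lteCoeff_succ]
  simp only [Matrix.mulVec, dotProduct, Pi.add_apply, Pi.smul_apply, smul_eq_mul, add_mul,
    Finset.mul_sum, Finset.sum_mul]
  congr 1
  · exact Finset.sum_congr rfl fun j _ => by ring
  · split_ifs with hk
    · simp [hk, fracKernel_one, Matrix.mulVec, dotProduct, Finset.mul_sum]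
    · simp

theorem isLTESolution_iff (hα₀ : 0 < α) (hα₁ : α < 1) (hβ : 0 < β)
    (hA : ∀ i j, 0 ≤ A i j) (hw₀ : ∀ i, w₀ i ∈ Set.Icc (0 : ℝ) 1) (y : ℝ → ι → EReal) :
    IsLTESolution α β A w₀ y ↔ ∀ t, 0 ≤ t → y t = lteSeries α β A w₀ t :=
  ⟨fun hy _ ht => hy.unique hα₀ hα₁ hβ hA hw₀
      (isLTESolution_of_eq_lteSeries hα₀ hα₁ hβ hA hw₀ fun _ _ => rfl) ht,
    isLTESolution_of_eq_lteSeries hα₀ hα₁ hβ hA hw₀⟩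

end

/-! ### The exact model: upper bound and long-time behaviour -/

section

variable {ι : Type*} [Fintype ι] {α β : ℝ} {A : Matrix ι ι ℝ} {w₀ : ι → ℝ}
  {y : ℝ → ι → EReal} {w v : ℝ → ι → ℝ}

lemma fFun_coe (r : ℝ) : fFun (r : EReal) = 1 - Real.exp (-r) := by
  rw [fFun, ← EReal.coe_neg, EReal.exp_coe, ENNReal.toReal_ofReal (Real.exp_pos _).le]

lemma fFun_top : fFun ⊤ = 1 := by simp [fFun]

lemma fFun_le_one (x : EReal) : fFun x ≤ 1 := sub_le_self _ ENNReal.toReal_nonneg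

lemma eq_one_sub_exp_of_lt {x : ℝ} (hx : x < 1) : x = 1 - Real.exp (-(gFun x).toReal) := by
  rw [gFun_of_lt hx, EReal.toReal_coe, neg_neg, Real.exp_log (by linarith)]
  ring

lemma IsExactSolution.eq_one (hw : IsExactSolution α β A w₀ w) {i : ι} (hi : w₀ i = 1) {t : ℝ}
    (ht : 0 ≤ t) : w t i = 1 := by
  have h := hasCaputoDerivExt_of_eq_top (hw.equation i) (by simp [hw.initial, hi, gFun_one]) ht
  refine (hw.mem_Icc t ht i).2.antisymm (not_lt.1 fun hlt => ?_)
  rw [gFun_of_lt hlt] at h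
  exact EReal.coe_ne_top _ h

lemma IsExactSolution.finite (hw : IsExactSolution α β A w₀ w) {i : ι} (hi : w₀ i < 1) :
    (∀ t : ℝ, 0 ≤ t → w t i < 1) ∧
      HasCaputoDeriv α (fun t => (gFun (w t i)).toReal) (fun t => β ^ α * (A *ᵥ w t) i) := by
  obtain ⟨h1, h2⟩ := (hw.equation i).finite
    (by simp only [hw.initial, gFun_of_lt hi]; exact EReal.coe_ne_top _)
  refine ⟨fun t ht => not_le.1 fun hle => ?_, h2⟩
  have := h1 t ht
  rw [gFun, if_neg (not_lt.2 hle)] at this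
  exact EReal.coe_ne_top _ this.symm

lemma IsExactSolution.continuousOn_gFun (hw₀ : ∀ i, w₀ i ∈ Set.Icc (0 : ℝ) 1)
    (hw : IsExactSolution α β A w₀ w) (i : ι) :
    ContinuousOn (fun t => (gFun (w t i)).toReal) (Set.Ici 0) := by
  rcases (hw₀ i).2.lt_or_eq with hi | hi
  · exact (hw.finite hi).2.continuousOn
  · exact (continuousOn_const (c := (0 : ℝ))).congr fun t ht => by
      simp [hw.eq_one hi (show 0 ≤ t from ht), gFun_one]

lemma IsExactSolution.continuousOn (hw₀ : ∀ i, w₀ i ∈ Set.Icc (0 : ℝ) 1)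
    (hw : IsExactSolution α β A w₀ w) (i : ι) :
    ContinuousOn (fun t => w t i) (Set.Ici 0) := by
  rcases (hw₀ i).2.lt_or_eq with hi | hi
  · exact (continuousOn_const.sub
      (Real.continuous_exp.comp_continuousOn (hw.continuousOn_gFun hw₀ i).neg)).congr
      fun t ht => eq_one_sub_exp_of_lt ((hw.finite hi).1 t ht)
  · exact (continuousOn_const (c := (1 : ℝ))).congr fun t ht => hw.eq_one hi ht

lemma IsExactSolution.continuousOn_deriv (hw₀ : ∀ i, w₀ i ∈ Set.Icc (0 : ℝ) 1)
    (hw : IsExactSolution α β A w₀ w) (i : ι) :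
    ContinuousOn (fun t => β ^ α * (A *ᵥ w t) i) (Set.Ici 0) :=
  (ContinuousOn.mulVec_apply (hw.continuousOn hw₀) A i).const_mul _

lemma IsExactSolution.deriv_nonneg (hβ : 0 < β) (hA : ∀ i j, 0 ≤ A i j)
    (hw : IsExactSolution α β A w₀ w) (i : ι) {t : ℝ} (ht : 0 ≤ t) :
    0 ≤ β ^ α * (A *ᵥ w t) i :=
  mul_nonneg (by positivity) (mulVec_apply_nonneg hA (fun j => (hw.mem_Icc t ht j).1) i)

lemma IsExactSolution.initial_le (hα₀ : 0 < α) (hα₁ : α < 1) (hβ : 0 < β) (hA : ∀ i j, 0 ≤ A i j)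
    (hw₀ : ∀ i, w₀ i ∈ Set.Icc (0 : ℝ) 1) (hw : IsExactSolution α β A w₀ w) (i : ι) {t : ℝ}
    (ht : 0 ≤ t) : w₀ i ≤ w t i := by
  rcases (hw₀ i).2.lt_or_eq with hi | hi
  · have h1 := (hw.finite hi).2.initial_le hα₀ hα₁ (hw.continuousOn_deriv hw₀ i)
      (fun s hs => hw.deriv_nonneg hβ hA i hs) ht
    simp only [hw.initial] at h1
    rw [eq_one_sub_exp_of_lt hi, eq_one_sub_exp_of_lt ((hw.finite hi).1 t ht)]
    gcongr
  · rw [hw.eq_one hi ht, hi]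

/-- Concavity of `1 - e^(-u)`: the tangent line at `g(w₀)` lies above. -/
lemma IsExactSolution.le_tangent (hw₀ : ∀ i, w₀ i ∈ Set.Icc (0 : ℝ) 1)
    (hw : IsExactSolution α β A w₀ w) (i : ι) {t : ℝ} (ht : 0 ≤ t) :
    w t i ≤ (1 - w₀ i) * (gFun (w t i)).toReal + bFun (w₀ i) := by
  rcases (hw₀ i).2.lt_or_eq with hi | hi
  · have hp : 0 < 1 - w₀ i := by linarith
    have h1 := eq_one_sub_exp_of_lt ((hw.finite hi).1 t ht)
    set u := (gFun (w t i)).toReal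
    -- The tangent inequality is `e^x ≥ 1 + x` at `x = g(w₀) - u`, scaled by `1 - w₀`.
    have h2 : Real.exp (-u) = (1 - w₀ i) * Real.exp (-u - Real.log (1 - w₀ i)) := by
      rw [Real.exp_sub, Real.exp_log hp]; field_simp
    have h3 := mul_le_mul_of_nonneg_left (Real.add_one_le_exp (-u - Real.log (1 - w₀ i))) hp.le
    rw [bFun, h1, h2]
    linarith
  · simp [hw.eq_one hi ht, hi, bFun]

/-- A coordinate with an eventually positive in-neighbour saturates. -/
lemma IsExactSolution.tendsto_one (hα₀ : 0 < α) (hα₁ : α < 1) (hβ : 0 < β)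
    (hA : ∀ i j, 0 ≤ A i j) (hw₀ : ∀ i, w₀ i ∈ Set.Icc (0 : ℝ) 1)
    (hw : IsExactSolution α β A w₀ w) {i j : ι} (hi : w₀ i < 1) (hij : 0 < A i j)
    {c T : ℝ} (hc : 0 < c) (hT : 0 ≤ T) (hj : ∀ t, T ≤ t → c ≤ w t j) :
    Tendsto (fun t => w t i) atTop (𝓝 1) := by
  have h1 : Tendsto (fun t => (gFun (w t i)).toReal) atTop atTop := by
    refine (hw.finite hi).2.tendsto_atTop hα₀ hα₁ (hw.continuousOn_deriv hw₀ i)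
      (fun s hs => hw.deriv_nonneg hβ hA i hs) (c := β ^ α * (A i j * c)) (by positivity) hT
      fun s hs => mul_le_mul_of_nonneg_left ?_ (by positivity)
    refine (mul_le_mul_of_nonneg_left (hj s hs) hij.le).trans ?_
    exact Finset.single_le_sum (f := fun j => A i j * w s j)
      (fun j _ => mul_nonneg (hA i j) (hw.mem_Icc s (hT.trans hs) j).1) (Finset.mem_univ j)
  have h2 : Tendsto (fun t => 1 - Real.exp (-(gFun (w t i)).toReal)) atTop (𝓝 (1 - 0)) :=
    tendsto_const_nhds.sub (Real.tendsto_exp_neg_atTop_nhds_zero.comp h1)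
  rw [sub_zero] at h2
  refine h2.congr' ?_
  filter_upwards [eventually_ge_atTop 0] with t ht
  exact (eq_one_sub_exp_of_lt ((hw.finite hi).1 t ht)).symm

/-- Gronwall applied to `-v`, whose initial value is nonpositive and can be dropped from the
integral equation. -/
lemma IsLinearSolution.nonneg (hα₀ : 0 < α) (hα₁ : α < 1) (hβ : 0 < β) (hA : ∀ i j, 0 ≤ A i j)
    (hw₀ : ∀ i, 0 ≤ w₀ i) (hv : IsLinearSolution α β A w₀ v) {t : ℝ} (ht : 0 ≤ t) (i : ι) :
    0 ≤ v t i := by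
  refine neg_nonpos.1 (nonpos_of_le_integral hα₀ (B := β ^ α • A) (z := fun t i => -v t i)
    (fun i j => mul_nonneg (by positivity) (hA i j)) (fun i => (hv.equation i).continuousOn.neg)
    (fun t ht i => Or.inr ?_) ht i)
  have h : ∀ s, ((β ^ α • A) *ᵥ fun i => -v s i) i = -(β ^ α * (A *ᵥ v s) i) := fun s => by
    rw [Matrix.smul_mulVec, Pi.smul_apply, smul_eq_mul, ← mul_neg, ← Pi.neg_apply,
      ← Matrix.mulVec_neg]
    rfl
  have h1 := (hv.equation i).eq_add_integral hα₀ hα₁ ht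
  simp only [h, mul_neg, intervalIntegral.integral_neg]
  rw [hv.initial] at h1
  linarith [hw₀ i]

/-- Nonnegativity gives `v ≥ w₀`, so where `(A w₀)_i > 0` the Caputo derivative never falls below
`β^α (A w₀)_i`. -/
lemma IsLinearSolution.exists_tendsto_atTop (hα₀ : 0 < α) (hα₁ : α < 1) (hβ : 0 < β)
    (hA : ∀ i j, 0 ≤ A i j) (hw₀ : ∀ i, 0 ≤ w₀ i) (hv : IsLinearSolution α β A w₀ v)
    (hne : A *ᵥ w₀ ≠ 0) : ∃ i, Tendsto (fun t => v t i) atTop atTop := by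
  obtain ⟨i, hi⟩ := Function.ne_iff.1 hne
  have hc : ∀ i, ContinuousOn (fun t => β ^ α * (A *ᵥ v t) i) (Set.Ici 0) := fun i =>
    (ContinuousOn.mulVec_apply (fun j => (hv.equation j).continuousOn) A i).const_mul _
  have hpos : ∀ i s, 0 ≤ s → 0 ≤ β ^ α * (A *ᵥ v s) i := fun i s hs =>
    mul_nonneg (by positivity)
      (mulVec_apply_nonneg hA (fun j => hv.nonneg hα₀ hα₁ hβ hA hw₀ hs j) i)
  have hge : ∀ j s, 0 ≤ s → w₀ j ≤ v s j := fun j s hs => by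
    simpa only [hv.initial] using (hv.equation j).initial_le hα₀ hα₁ (hc j) (hpos j) hs
  have hi0 : 0 < (A *ᵥ w₀) i := lt_of_le_of_ne (mulVec_apply_nonneg hA hw₀ i) (Ne.symm hi)
  refine ⟨i, (hv.equation i).tendsto_atTop hα₀ hα₁ (hc i) (hpos i)
    (c := β ^ α * (A *ᵥ w₀) i) (by positivity) le_rfl fun s hs =>
    mul_le_mul_of_nonneg_left (Finset.sum_le_sum fun j _ =>
      mul_le_mul_of_nonneg_left (hge j s hs) (hA i j)) (by positivity)⟩

variable [DecidableEq ι]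

/-- The tangent bound on each `w_j` gives `A w ≤ Â g(w) + A b(w₀)`, so Gronwall applies to `g(w) -
ŷ`. -/
lemma IsExactSolution.gFun_le (hα₀ : 0 < α) (hα₁ : α < 1) (hβ : 0 < β) (hA : ∀ i j, 0 ≤ A i j)
    (hw₀ : ∀ i, w₀ i ∈ Set.Icc (0 : ℝ) 1) (hw : IsExactSolution α β A w₀ w)
    (hy : IsLTESolution α β A w₀ y) {t : ℝ} (ht : 0 ≤ t) (i : ι) :
    (gFun (w t i)).toReal ≤ (y t i).toReal := by
  have hz : ∀ i, ContinuousOn (fun t => (gFun (w t i)).toReal - (y t i).toReal) (Set.Ici 0) :=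
    fun i => (hw.continuousOn_gFun hw₀ i).sub (hy.continuousOn hw₀ i)
  refine sub_nonpos.1 (nonpos_of_le_integral hα₀ (B := β ^ α • hatMatrix A w₀)
    (z := fun t i => (gFun (w t i)).toReal - (y t i).toReal)
    (fun i j => mul_nonneg (by positivity) (hatMatrix_nonneg hA hw₀ i j)) hz
    (fun t ht i => ?_) ht i)
  rcases (hw₀ i).2.lt_or_eq with hi | hi
  · refine Or.inr ((hw.finite hi).2.sub_le_integral hα₀ hα₁ (hy.finite hi).2
      (by simp only [hw.initial, hy.initial]) (hw.continuousOn_deriv hw₀ i)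
      (hy.continuousOn_deriv hw₀ i) (ContinuousOn.mulVec_apply hz _ i) (fun s hs => ?_) ht)
    rw [Matrix.smul_mulVec, Pi.smul_apply, smul_eq_mul, ← mul_add, ← mul_sub]
    refine mul_le_mul_of_nonneg_left ?_ (by positivity)
    simp only [Matrix.mulVec, dotProduct, ← Finset.sum_add_distrib, ← Finset.sum_sub_distrib,
      hatMatrix_apply]
    refine Finset.sum_le_sum fun j _ => ?_
    have := mul_le_mul_of_nonneg_left (hw.le_tangent hw₀ j hs) (hA i j)
    linarith
  · left; simp [hy.eq_top hi ht, hw.eq_one hi ht, gFun_one]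

lemma IsExactSolution.le_fFun (hα₀ : 0 < α) (hα₁ : α < 1) (hβ : 0 < β) (hA : ∀ i j, 0 ≤ A i j)
    (hw₀ : ∀ i, w₀ i ∈ Set.Icc (0 : ℝ) 1) (hw : IsExactSolution α β A w₀ w)
    (hy : IsLTESolution α β A w₀ y) {t : ℝ} (ht : 0 ≤ t) (i : ι) : w t i ≤ fFun (y t i) := by
  rcases (hw₀ i).2.lt_or_eq with hi | hi
  · rw [(hy.finite hi).1 t ht, fFun_coe, eq_one_sub_exp_of_lt ((hw.finite hi).1 t ht)]
    have := hw.gFun_le hα₀ hα₁ hβ hA hw₀ hy ht i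
    gcongr
  · rw [hy.eq_top hi ht, fFun_top, hw.eq_one hi ht]

/-- The linearized solution vanishes on every set of coordinates that starts at zero and is
closed under in-neighbours. -/
lemma IsLTESolution.nonpos_of_closed (hα₀ : 0 < α) (hα₁ : α < 1) (hβ : 0 < β)
    (hA : ∀ i j, 0 ≤ A i j) (hw₀ : ∀ i, w₀ i ∈ Set.Icc (0 : ℝ) 1)
    (hy : IsLTESolution α β A w₀ y) {Z : Set ι} (hZ0 : ∀ i ∈ Z, w₀ i = 0)
    (hZ : ∀ i ∈ Z, ∀ j ∉ Z, A i j = 0) {i : ι} (hi : i ∈ Z) {t : ℝ} (ht : 0 ≤ t) :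
    (y t i).toReal ≤ 0 := by
  classical
  -- Extension by zero off `Z` loses nothing in the rows of `Z`, whose entries outside `Z` vanish;
  -- the forcing there vanishes too because `b(0) = 0`.
  set z : ℝ → ι → ℝ := fun t i => if i ∈ Z then (y t i).toReal else 0 with hz
  have hzc : ∀ i, ContinuousOn (fun t => z t i) (Set.Ici 0) := fun i => by
    by_cases h : i ∈ Z
    · simpa only [hz, if_pos h] using hy.continuousOn hw₀ i
    · simpa only [hz, if_neg h] using continuousOn_const
  have key := nonpos_of_le_integral hα₀ (B := β ^ α • hatMatrix A w₀) (z := z)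
    (fun i j => mul_nonneg (by positivity) (hatMatrix_nonneg hA hw₀ i j)) hzc
    (fun t ht i => ?_) ht i
  · simpa only [hz, if_pos hi] using key
  by_cases h : i ∈ Z
  swap
  · left; simp only [hz, if_neg h, le_refl]
  right
  have hlt : w₀ i < 1 := by rw [hZ0 i h]; exact one_pos
  have hd : ∀ s, β ^ α * (hatMatrix A w₀ *ᵥ fun j => (y s j).toReal) i
      + β ^ α * (A *ᵥ fun j => bFun (w₀ j)) i = ((β ^ α • hatMatrix A w₀) *ᵥ z s) i := fun s => by
    rw [Matrix.smul_mulVec, Pi.smul_apply, smul_eq_mul, ← mul_add]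
    congr 1
    simp only [Matrix.mulVec, dotProduct, ← Finset.sum_add_distrib]
    refine Finset.sum_congr rfl fun j _ => ?_
    by_cases hj : j ∈ Z
    · simp [hz, hj, hZ0 j hj, bFun]
    · simp [hatMatrix_apply, hZ i h j hj]
  have := (hy.finite hlt).2.eq_add_integral hα₀ hα₁ ht
  simp only [hd, hy.toReal_zero, hZ0 i h, gFun_of_lt one_pos] at this
  simp only [hz, if_pos h] at this ⊢
  rw [this]
  simp

lemma IsExactSolution.tendsto_sub (hα₀ : 0 < α) (hα₁ : α < 1) (hβ : 0 < β)
    (hA : ∀ i j, 0 ≤ A i j) (hw₀ : ∀ i, w₀ i ∈ Set.Icc (0 : ℝ) 1)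
    (hw : IsExactSolution α β A w₀ w) (hy : IsLTESolution α β A w₀ y) (i : ι) :
    Tendsto (fun t => fFun (y t i) - w t i) atTop (𝓝 0) := by
  -- The nodes that are not live. A live in-neighbour would drive such a node to `1` and make it
  -- live, so `Z` is closed under in-neighbours.
  set Z : Set ι := {j | ¬ ∃ c > 0, ∃ T ≥ 0, ∀ t, T ≤ t → c ≤ w t j} with hZdef
  have hP : ∀ j ∉ Z, ∃ c > 0, ∃ T ≥ 0, ∀ t, T ≤ t → c ≤ w t j := fun j hj => not_not.1 hj
  have hZ0 : ∀ j ∈ Z, w₀ j = 0 := fun j hj => by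
    by_contra h
    exact hj ⟨w₀ j, lt_of_le_of_ne (hw₀ j).1 (Ne.symm h), 0, le_rfl, fun t ht =>
      hw.initial_le hα₀ hα₁ hβ hA hw₀ j ht⟩
  have hZ : ∀ i ∈ Z, ∀ j ∉ Z, A i j = 0 := fun i hi j hj => by
    by_contra h
    obtain ⟨c, hc, T, hT, hcT⟩ := hP j hj
    have hlt : w₀ i < 1 := by rw [hZ0 i hi]; exact one_pos
    have h1 := hw.tendsto_one hα₀ hα₁ hβ hA hw₀ hlt
      (lt_of_le_of_ne (hA i j) (Ne.symm h)) hc hT hcT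
    obtain ⟨T', hT'⟩ := eventually_atTop.1 (h1.eventually (lt_mem_nhds (one_half_lt_one (α := ℝ))))
    exact hi ⟨1 / 2, by norm_num, max T' 0, le_max_right _ _, fun t ht =>
      (hT' t ((le_max_left _ _).trans ht)).le⟩
  -- Since `ŷ ≤ 0` on `Z`, the chain `0 ≤ w ≤ f(ŷ) ≤ 0` collapses.
  have hY : ∀ j ∈ Z, ∀ t, 0 ≤ t → w t j = 0 ∧ (y t j).toReal = 0 := fun j hj t ht => by
    have hlt : w₀ j < 1 := by rw [hZ0 j hj]; exact one_pos
    have h1 := hy.nonpos_of_closed hα₀ hα₁ hβ hA hw₀ hZ0 hZ hj ht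
    have h2 := hw.le_fFun hα₀ hα₁ hβ hA hw₀ hy ht j
    have h3 := (hw.mem_Icc t ht j).1
    rw [(hy.finite hlt).1 t ht, fFun_coe] at h2
    have h4 := Real.one_le_exp (neg_nonneg.2 h1)
    have h5 : Real.exp (-(y t j).toReal) ≤ 1 := by linarith
    refine ⟨by linarith, ?_⟩
    rw [Real.exp_le_one_iff] at h5
    linarith
  rcases (hw₀ i).2.lt_or_eq with hi | hi
  swap
  · refine tendsto_const_nhds.congr' ?_
    filter_upwards [eventually_ge_atTop 0] with t ht
    rw [hy.eq_top hi ht, fFun_top, hw.eq_one hi ht, sub_self]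
  by_cases h : ∃ j, j ∉ Z ∧ A i j ≠ 0
  · obtain ⟨j, hj, hij⟩ := h
    obtain ⟨c, hc, T, hT, hcT⟩ := hP j hj
    have h1 := hw.tendsto_one hα₀ hα₁ hβ hA hw₀ hi
      (lt_of_le_of_ne (hA i j) (Ne.symm hij)) hc hT hcT
    have h2 : Tendsto (fun t => 1 - w t i) atTop (𝓝 0) := by
      simpa using (tendsto_const_nhds (x := (1 : ℝ))).sub h1
    refine tendsto_of_tendsto_of_tendsto_of_le_of_le' tendsto_const_nhds h2 ?_ ?_
    · filter_upwards [eventually_ge_atTop 0] with t ht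
      exact sub_nonneg.2 (hw.le_fFun hα₀ hα₁ hβ hA hw₀ hy ht i)
    · exact Eventually.of_forall fun t => sub_le_sub_right (fFun_le_one _) _
  -- No live in-neighbour: both right-hand sides vanish identically, so both solutions stay at the
  -- same initial value, whether or not `i` itself is live.
  · push Not at h
    have hu : ∀ s, 0 ≤ s → β ^ α * (A *ᵥ w s) i = 0 := fun s hs => by
      refine mul_eq_zero_of_right _ (Finset.sum_eq_zero fun j _ => ?_)
      by_cases hj : j ∈ Z
      · simp [(hY j hj s hs).1]
      · simp [h j hj]
    have hy' : ∀ s, 0 ≤ s → β ^ α * (hatMatrix A w₀ *ᵥ fun j => (y s j).toReal) i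
        + β ^ α * (A *ᵥ fun j => bFun (w₀ j)) i = 0 := fun s hs => by
      rw [← mul_add]
      refine mul_eq_zero_of_right _ ?_
      simp only [Matrix.mulVec, dotProduct, ← Finset.sum_add_distrib]
      refine Finset.sum_eq_zero fun j _ => ?_
      by_cases hj : j ∈ Z
      · simp [(hY j hj s hs).2, hZ0 j hj, bFun]
      · simp [hatMatrix_apply, h j hj]
    refine tendsto_const_nhds.congr' ?_
    filter_upwards [eventually_ge_atTop 0] with t ht
    rw [(hy.finite hi).1 t ht, fFun_coe, (hy.finite hi).2.eq_initial hα₀ hα₁ hy' ht,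
      hy.toReal_zero]
    have h1 := eq_one_sub_exp_of_lt ((hw.finite hi).1 t ht)
    rw [(hw.finite hi).2.eq_initial hα₀ hα₁ hu ht, hw.initial] at h1
    rw [h1, sub_self]

end

end WasteCongestion

end

open WasteCongestion
theorem mainTheorem1 {ι : Type*} [Fintype ι] [DecidableEq ι]
    (A : Matrix ι ι ℝ) (hA : ∀ i j, 0 ≤ A i j)
    (α β : ℝ) (hα₀ : 0 < α) (hα₁ : α < 1) (hβ : 0 < β)
    (w₀ : ι → ℝ) (hw₀ : ∀ i, w₀ i ∈ Set.Icc (0 : ℝ) 1) :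
    -- the two series converge, and their sum is the unique solution of the linearized system
    (∀ t : ℝ, 0 ≤ t →
      Summable (mittagLefflerTerm α ((β * t) ^ α • hatMatrix A w₀)) ∧
      Summable (forcingTerm α β A w₀ t)) ∧
    (∀ y : ℝ → ι → EReal,
      IsLTESolution α β A w₀ y ↔ ∀ t : ℝ, 0 ≤ t → y t = lteSeries α β A w₀ t) ∧
    ∀ w : ℝ → ι → ℝ, IsExactSolution α β A w₀ w →
      (∀ y : ℝ → ι → EReal, IsLTESolution α β A w₀ y →
        (∀ t : ℝ, 0 ≤ t → ∀ i, w t i ≤ fFun (y t i)) ∧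
        Tendsto (fun t : ℝ => ‖(fun i => fFun (y t i)) - w t‖) atTop (𝓝 0)) ∧
      (∀ v : ℝ → ι → ℝ, IsLinearSolution α β A w₀ v → A *ᵥ w₀ ≠ 0 →
        Tendsto (fun t : ℝ => ‖v t - w t‖) atTop atTop) := by
  refine ⟨fun t ht => ⟨summable_mittagLefflerTerm hα₀ _, summable_forcingTerm hα₀ hβ A w₀ ht⟩,
    isLTESolution_iff hα₀ hα₁ hβ hA hw₀, fun w hw => ⟨fun y hy =>
      ⟨fun t ht i => hw.le_fFun hα₀ hα₁ hβ hA hw₀ hy ht i, ?_⟩, fun v hv hne => ?_⟩⟩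
  · rw [← tendsto_zero_iff_norm_tendsto_zero, tendsto_pi_nhds]
    exact fun i => hw.tendsto_sub hα₀ hα₁ hβ hA hw₀ hy i
  · obtain ⟨i, hi⟩ := hv.exists_tendsto_atTop hα₀ hα₁ hβ hA (fun j => (hw₀ j).1) hne
    -- The constant `-1` comes from `w ≤ 1`: the norm is at least `v_i - w_i ≥ v_i - 1`.
    refine tendsto_atTop_mono' _ ?_ (tendsto_atTop_add_const_right _ (-1) hi)
    filter_upwards [eventually_ge_atTop 0] with t ht
    calc v t i + -1 ≤ (v t - w t) i := by
          rw [Pi.sub_apply]; linarith [(hw.mem_Icc t ht i).2]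
      _ ≤ ‖(v t - w t) i‖ := le_abs_self _
      _ ≤ _ := norm_le_pi_norm _ i
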